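/- Let $n\ge 0$ and $q\ge 1$ be integers, and let $\mathcal P(n,q)$ be the lattice of all subspaces of $K^n$, where $K$ is a field with $q$ elements, if $q>1$ is a prime power, and the lattice of all subsets of an $n$-set if $q=1$; it is ranked by dimension, respectively by size. Let $F$ be a field of prime characteristic $p$ coprime to $q$, let $G$ be a group of automorphisms of the poset $\mathcal P(n,q)$, and let $U$ be an irreducible $FG$-module. Let $\pi=\pi(p,q)$ be the least integer $m>0$ such that $p$ divides $1+q+\dots+q^{m-1}$ (so $\pi(p,1)=p$). For $k\in\mathbb Z$ let $M_k$ be the permutation $FG$-module whose basis is the set of elements of rank $k$ of $\mathcal P(n,q)$ (so $M_k=0$ unless $0\le k\le n$), and let $\partial\colon\bigoplus_k M_k\to\bigoplus_k M_k$ be the incidence map, $\partial(x)=\sum y$ over all $y\le x$ with $\operatorname{rk}y=\operatorname{rk}x-1$. For an $FG$-module $M$ of finite length let $c(M,U)$ be the multiplicity of $U$ as a composition factor of $M$; put $c_k=c(M_k,U)$ and $[c_k]_\pi=\sum_{t\in\mathbb Z}c_{k+t\pi}$. For integers $l,r$ with $0<r-l<\pi$ let $\mathcal M_{(l,r)}$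 be the sequence $$\cdots\leftarrow M_{r-\pi}\leftarrow M_l\leftarrow M_r\leftarrow M_{l+\pi}\leftarrow M_{r+\pi}\leftarrow\cdots$$ whose arrows are the appropriate powers of $\partial$. Its homology at $M_{j-i}\leftarrow M_j\leftarrow M_{j+\pi-i}$ is $H_{j,i}=(\ker\partial^i\cap M_j)/\partial^{\pi-i}(M_{j+\pi-i})$. The type of the sequence is the pair $(a,b)$ such that $M_a\leftarrow M_b$ is its unique arrow with $0\le a+b<\pi$; positions in the sequence are counted by integers, increasing to the right, with $M_b$ in position $0$. Then $c_k=c_{n-k}$ for all $k\in\mathbb Z$. Moreover, for all integers $l,r$ with $0<r-l<\pi$, the sequence $\mathcal M_{(l,r)}$ is almost exact, that is, it has at most one nonzero homology module. Let $(a,b)$ be its type and let $d$ be the position of the nonzero homology (any position, if all homology modules vanish), and let $H_{(l,r)}$ be the homology in position $d$. Then $$c(H_{(l,r)},U)=(-1)^d\bigl([c_b]_\pi-[c_a]_\pi\bigr).$$ In particular $[c_a]_\pi\le[c_b]_\pi$ if $d$ is even, and $[c_b]_\pi\le[c_a]_\pi$ if $d$ is odd. -/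

import Mathlib

noncomputable section

namespace IncidenceHomology

/-! ### Composition multiplicities -/

section Multiplicity

variable {R : Type*} [Ring R] {M : Type*} [AddCommGroup M] [Module R M]

/-- The number of factors of the composition series `s` that are isomorphic to `U`. -/
def factorCount (s : CompositionSeries (Submodule R M))
    (U : Type*) [AddCommGroup U] [Module R U] : ℕ :=
  Nat.card {i : Fin s.length //
    Nonempty ((↥(s i.succ) ⧸ (s i.castSucc).submoduleOf (s i.succ)) ≃ₗ[R] U)}

variable (R M)

/-- `mult R M U` is the multiplicity of `U` as a composition factor of the `R`-module `M`, counted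
in any composition series from `0` to `M` (see `mult_eq`; it is `0` if there is none, that is, if
`M` does not have finite length). -/
def mult (U : Type*) [AddCommGroup U] [Module R U] : ℕ :=
  open Classical in
  if h : ∃ s : CompositionSeries (Submodule R M), s.head = ⊥ ∧ s.last = ⊤ then
    factorCount h.choose U
  else 0

variable {R M}

/-- The multiplicity does not depend on the composition series used to compute it. -/
theorem mult_eq (U : Type*) [AddCommGroup U] [Module R U]
    (s : CompositionSeries (Submodule R M)) (h₀ : s.head = ⊥) (h₁ : s.last = ⊤) :
    mult R M U = factorCount s U := by
  have h : ∃ s : CompositionSeries (Submodule R M), s.head = ⊥ ∧ s.last = ⊤ := ⟨s, h₀, h₁⟩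
  rw [mult, dif_pos h]
  obtain ⟨f, hf⟩ := CompositionSeries.jordan_holder h.choose s
    (h.choose_spec.1.trans h₀.symm) (h.choose_spec.2.trans h₁.symm)
  refine Nat.card_congr (f.subtypeEquiv fun i => ?_)
  have e := (hf i).linearEquiv
  exact ⟨fun ⟨g⟩ => ⟨e.symm.trans g⟩, fun ⟨g⟩ => ⟨e.trans g⟩⟩

end Multiplicity

/-! ### The posets `P(n,q)` -/

/-- `IsPnq n q Q`: the poset `Q` is (a copy of) `P(n,q)`, that is, the lattice of all subsets of an
`n`-set if `q = 1`, or the lattice of all subspaces of `K ^ n` for a field `K` with `q` elements. -/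
def IsPnq (n q : ℕ) (Q : Type*) [PartialOrder Q] : Prop :=
  (q = 1 ∧ Nonempty (Q ≃o Finset (Fin n))) ∨
  ∃ (K : Type) (_ : Field K), Finite K ∧ Nat.card K = q ∧
    Nonempty (Q ≃o Submodule K (Fin n → K))

/-- The rank of an element of a finite poset: the maximal length of a chain below it. -/
def rk {Q : Type*} [PartialOrder Q] (x : Q) : ℕ := (Order.height x).toNat

theorem rk_orderIso {Q Q' : Type*} [PartialOrder Q] [PartialOrder Q'] (e : Q ≃o Q') (x : Q) :
    rk (e x) = rk x := by
  rw [rk, rk, Order.height_orderIso]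

/-- The rank of a set is its size. -/
theorem rk_finset {α : Type*} (s : Finset α) : rk s = s.card := by
  classical
  have h : Order.height s = s.card := by
    apply le_antisymm
    · have := Order.height_le_height_apply_of_strictMono (Finset.card : Finset α → ℕ)
        (fun _ _ h => Finset.card_lt_card h) s
      simpa using this
    · induction s using Finset.induction_on with
      | empty => simp
      | insert a s ha ih =>
        rw [Finset.card_insert_of_notMem ha]
        have h2 := Order.height_add_one_le (Finset.ssubset_insert ha)
        push_cast
        exact (add_le_add_left ih 1).trans h2
  rw [rk, h]; rfl

/-- The rank of a subspace is its dimension. -/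
theorem rk_submodule {K V : Type*} [Field K] [AddCommGroup V] [Module K V]
    [FiniteDimensional K V] (W : Submodule K V) : rk W = Module.finrank K W := by
  have h : Order.height W = Module.finrank K W := by
    rw [← Module.length_submodule, Module.length_eq_finrank]
  rw [rk, h]; rfl

/-- `qchar p q` is the characteristic `π(p,q)` of `q` modulo `p`: the least `m > 0` such that `p`
divides `1 + q + ⋯ + q ^ (m - 1)`. For `q = 1` this is `p`. -/
def qchar (p q : ℕ) : ℕ := sInf {m : ℕ | 0 < m ∧ p ∣ ∑ s ∈ Finset.range m, q ^ s}

/-! ### The permutation module and the incidence map -/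

section Modules

variable (F : Type*) [Field F] {Q : Type*} [PartialOrder Q]

/-- The permutation representation of `G` on the vector space with basis `Q`. -/
def permRep (G : Subgroup (Q ≃o Q)) : Representation F G (Q →₀ F) where
  toFun g := Finsupp.lmapDomain F F (fun x => g • x)
  map_one' := by ext; simp
  map_mul' g h := by ext; simp [mul_smul]

/-- The `FG`-module `M = FQ` with basis `Q`. -/
def FQ (_G : Subgroup (Q ≃o Q)) : Type _ := Q →₀ F

instance (G : Subgroup (Q ≃o Q)) : AddCommGroup (FQ F G) :=
  inferInstanceAs (AddCommGroup (Q →₀ F))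

instance (G : Subgroup (Q ≃o Q)) : Module F (FQ F G) :=
  inferInstanceAs (Module F (Q →₀ F))

/-- `FQ` as a space of finitely supported functions. -/
def toFinsupp (G : Subgroup (Q ≃o Q)) : FQ F G ≃ₗ[F] (Q →₀ F) := LinearEquiv.refl F (Q →₀ F)

/-- The group algebra acts on `FQ` by extending the permutation representation linearly. -/
instance (G : Subgroup (Q ≃o Q)) : Module (MonoidAlgebra F G) (FQ F G) :=
  Module.compHom (Q →₀ F) (permRep F G).asAlgebraHom.toRingHom

theorem toFinsupp_smul (G : Subgroup (Q ≃o Q)) (a : MonoidAlgebra F G) (v : FQ F G) :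
    toFinsupp F G (a • v) = (permRep F G).asAlgebraHom a (toFinsupp F G v) := rfl

theorem permRep_single (G : Subgroup (Q ≃o Q)) (g : G) (x : Q) (c : F) :
    permRep F G g (Finsupp.single x c) = Finsupp.single ((g : Q ≃o Q) x) c := by
  simp only [permRep, MonoidHom.coe_mk, OneHom.coe_mk, Finsupp.lmapDomain_apply,
    Finsupp.mapDomain_single]
  rfl

/-- The `FG`-submodule `M_k` of `FQ`, spanned by the elements of `Q` of rank `k`
(`k` an arbitrary integer; `M_k = 0` if there are no such elements). -/
def MRank (G : Subgroup (Q ≃o Q)) (k : ℤ) : Submodule (MonoidAlgebra F G) (FQ F G) where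
  carrier := {v | toFinsupp F G v ∈ Finsupp.supported F F {x : Q | (rk x : ℤ) = k}}
  add_mem' {v w} hv hw := by
    simp only [Set.mem_ofPred_eq, map_add] at hv hw ⊢
    exact add_mem hv hw
  zero_mem' := by simp
  smul_mem' a v hv := by
    simp only [Set.mem_ofPred_eq, toFinsupp_smul] at hv ⊢
    refine Representation.asAlgebraHom_mem_of_forall_mem _ _ (fun g w hw => ?_) _ hv a
    have : Finsupp.lmapDomain F F (fun x : Q => g • x) w ∈
        Finsupp.supported F F ((fun x : Q => g • x) '' {x : Q | (rk x : ℤ) = k}) := by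
      rw [← Finsupp.lmapDomain_supported]
      exact Submodule.mem_map_of_mem hw
    refine Finsupp.supported_mono ?_ this
    rintro _ ⟨x, hx, rfl⟩
    have h : rk (g • x) = rk x := rk_orderIso (g : Q ≃o Q) x
    simpa [h] using hx

variable [Fintype Q]

open Classical in
/-- The incidence map as an `F`-linear map: the basis element `x` is sent to the sum of all `y ≤ x`
of rank `rk x - 1`. -/
def incidenceLin : (Q →₀ F) →ₗ[F] (Q →₀ F) :=
  Finsupp.linearCombination F fun x : Q =>
    ∑ y : Q with y ≤ x ∧ rk y + 1 = rk x, Finsupp.single y (1 : F)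

open Classical in
theorem incidenceLin_single (x : Q) (c : F) :
    incidenceLin F (Finsupp.single x c) =
      c • ∑ y : Q with y ≤ x ∧ rk y + 1 = rk x, Finsupp.single y (1 : F) := by
  simp [incidenceLin]

theorem incidenceLin_permRep (G : Subgroup (Q ≃o Q)) (g : G) (v : Q →₀ F) :
    incidenceLin F (permRep F G g v) = permRep F G g (incidenceLin F v) := by
  classical
  induction v using Finsupp.induction_linear with
  | zero => simp
  | add v w hv hw => simp [hv, hw]
  | single x c =>
    rw [permRep_single, incidenceLin_single, incidenceLin_single, map_smul, map_sum]
    congr 1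
    symm
    refine Finset.sum_equiv (g : Q ≃o Q).toEquiv (fun y => ?_) (fun y _ => ?_)
    · simp [rk_orderIso]
    · rw [permRep_single]; rfl

/-- The incidence map `∂` as an endomorphism of the `FG`-module `FQ`. -/
def bd (G : Subgroup (Q ≃o Q)) : Module.End (MonoidAlgebra F G) (FQ F G) where
  toFun v := (toFinsupp F G).symm (incidenceLin F (toFinsupp F G v))
  map_add' v w := by simp
  map_smul' a v := by
    apply (toFinsupp F G).injective
    simp only [LinearEquiv.apply_symm_apply, toFinsupp_smul, RingHom.id_apply]
    induction a using MonoidAlgebra.induction_linear with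
    | zero => simp
    | add a b ha hb => simp [map_add, ha, hb]
    | single g c => simp [Representation.asAlgebraHom_single, incidenceLin_permRep]

/-- The generalized homology module
`H_{j,i} = (ker ∂^i ∩ M_j) / ∂^(π-i) (M_(j+π-i))`, for `0 < i < π`. -/
abbrev H (G : Subgroup (Q ≃o Q)) (π : ℕ) (j : ℤ) (i : ℕ) : Type _ :=
  ↥(LinearMap.ker (bd F G ^ i) ⊓ MRank F G j) ⧸
    ((MRank F G (j + (π - i : ℕ))).map (bd F G ^ (π - i))).submoduleOf
      (LinearMap.ker (bd F G ^ i) ⊓ MRank F G j)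

end Modules

/-! ### The sequences `M_(l,r)` -/

/-- The indices of the modules in the sequence
`⋯ ← M_l ← M_r ← M_(l+π) ← M_(r+π) ← ⋯` determined by the arrow `M_l ← M_r`,
where `e` is the position counted from `M_r`. -/
def term (π : ℕ) (l r e : ℤ) : ℤ :=
  if Even e then r + π * (e / 2) else l + π * ((e + 1) / 2)

/-- `(a,b)` is the type of the sequence `M_(l,r)`: the arrow `M_a ← M_b` occurs in the sequence,
and `0 ≤ a + b < π`. -/
def IsTypeOf (π : ℕ) (l r a b : ℤ) : Prop :=
  (∃ e : ℤ, a = term π l r (e - 1) ∧ b = term π l r e) ∧ 0 ≤ a + b ∧ a + b < π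

theorem term_add_term (π : ℕ) (l r e : ℤ) :
    term π l r (e - 1) + term π l r e = l + r + π * e := by
  rcases Int.even_or_odd' e with ⟨t, rfl | rfl⟩
  · have h1 : ¬ Even (2 * t - 1) := by simp
    have h2 : (2 * t - 1 + 1) / 2 = t := by omega
    have h3 : (2 * t) / 2 = t := by omega
    rw [term, term, if_neg h1, if_pos (even_two_mul t), h2, h3]; ring
  · have h1 : ¬ Even (2 * t + 1) := by simp
    have h2 : (2 * t + 1 + 1) / 2 = t + 1 := by omega
    have h3 : (2 * t + 1 - 1) / 2 = t := by omega
    have h4 : Even (2 * t + 1 - 1) := by simp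
    rw [term, term, if_pos h4, if_neg h1, h2, h3]; ring

/-- Each sequence has exactly one type. -/
theorem existsUnique_isTypeOf (π : ℕ) (hπ : 0 < π) (l r : ℤ) :
    ∃! ab : ℤ × ℤ, IsTypeOf π l r ab.1 ab.2 := by
  have hπ' : (0 : ℤ) < π := by exact_mod_cast hπ
  have key : ∀ e : ℤ, 0 ≤ l + r + π * e ∧ l + r + π * e < π ↔ e = -((l + r) / π) := by
    intro e
    have h1 := Int.emod_add_mul_ediv (l + r) π
    have h2 := Int.emod_nonneg (l + r) hπ'.ne'
    have h3 := Int.emod_lt_of_pos (l + r) hπ'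
    constructor
    · rintro ⟨h4, h5⟩
      have h6 : (π : ℤ) * (e + (l + r) / π) < π * 1 := by linarith
      have h7 : (π : ℤ) * (-1) < π * (e + (l + r) / π) := by linarith
      have h8 := lt_of_mul_lt_mul_left h6 hπ'.le
      have h9 := lt_of_mul_lt_mul_left h7 hπ'.le
      omega
    · rintro rfl
      constructor <;> linarith
  refine ⟨(term π l r (-((l + r) / π) - 1), term π l r (-((l + r) / π))), ?_, ?_⟩
  · have := (key _).2 rfl
    rw [← term_add_term] at this
    exact ⟨⟨_, rfl, rfl⟩, this⟩
  · rintro ⟨a, b⟩ ⟨⟨e, ha, hb⟩, h1, h2⟩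
    dsimp only at ha hb h1 h2
    have := (key e).1 (by rw [← term_add_term, ← ha, ← hb]; exact ⟨h1, h2⟩)
    rw [ha, hb, this]

section Sequences

variable (F : Type*) [Field F] {Q : Type*} [PartialOrder Q] [Fintype Q]

/-- The homology of the sequence determined by `M_l ← M_r` at the module in position `e`, counted
from `M_r`. The arrow leaving that module is `∂^i` with `i` the difference of the indices. -/
abbrev HAt (G : Subgroup (Q ≃o Q)) (π : ℕ) (l r e : ℤ) : Type _ :=
  H F G π (term π l r e) (term π l r e - term π l r (e - 1)).toNat

/-- `M_(l,r)` is almost exact: at most one of its homology modules is nonzero. -/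
def AlmostExact (G : Subgroup (Q ≃o Q)) (π : ℕ) (l r : ℤ) : Prop :=
  {e : ℤ | Nontrivial (HAt F G π l r e)}.Subsingleton

end Sequences

/-- `[f_k]_π = ∑_{t ∈ ℤ} f (k + t π)`, for functions `f` of finite support and `π > 0`. -/
def bracket (π : ℕ) (f : ℤ → ℕ) (k : ℤ) : ℤ := ∑ᶠ t : ℤ, (f (k + t * π) : ℤ)

end IncidenceHomology

end

/-!
Let `∂` be the incidence map, acting on functions on `P(n,q)`, and call `f` a chain below `a` if it
is supported on the elements of one rank below `a`.

*Almost exactness.* The homology `H_{j,i}` of a geometry of rank `n` vanishes unless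
`n - π < 2 * j - i < n` (`exists_dn_pow_eq`). As `2 * j - i` is the sum of the indices of the arrow
`M_{j-i} ← M_j`, and consecutive arrows of a sequence have sums that differ by `π`, at most one
homology module of the sequence survives. The vanishing is proved by induction on the rank. Fix a
hyperplane `b` of `a`. In the case of subspaces, the elations with axis `b` form a group of order
prime to `p`, and its characters split the chains below `a` into a part built from two copies of
the chains below `b`, and copies of the chains below hyperplanes of `b`. The splitting is carried
out without characters, by averaging, and also covers the case of sets (`chain_decomposition`,
`exists_decomposition_of_dn_pow_eq_zero`). On the first part `∂` acts by a twisted Leibniz rule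
(`dn_lift`), in which the numbers `[i] = 1 + q + ⋯ + q ^ (i - 1)` occur. They are nonzero in `F` for
`0 < i < π`, while `[π] = 0`, and this reduces exactness for `(n, 2 * j - i)` to exactness for `n - 1` and
`2 * j - i - 1`; the second part needs exactness for `n - 2` and `2 * j - i - 2`. The condition on
`2 * j - i` is stable under both reductions.

*Multiplicities.* Multiplicities are additive along short exact sequences
(`mult_eq_add_of_surjective`), so the Euler characteristic of a sequence can be computed from its
modules as well as from its homology (`mult_HAt_eq`).

*Symmetry.* The map sending `x` to the sum of all `y` with `x ⊓ y = 0` is invertible over `F`,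
because Möbius inversion factors its matrix into triangular matrices whose diagonal entries are,
up to sign, powers of `q` (`meetSum_injective`). It is antitriangular with respect to the rank, so
its blocks `M_k → M_{n-k}` are injective (`eq_zero_of_meetSum_eq_zero`).
-/

noncomputable section

namespace IncidenceHomology

open Finset

/-! ### Lattices that look like `P(n,q)` -/

/-- The `q`-analogue `1 + q + ⋯ + q ^ (m - 1)` of the natural number `m`. -/
def qInt (q m : ℕ) : ℕ := ∑ s ∈ range m, q ^ s

@[simp] theorem qInt_zero (q : ℕ) : qInt q 0 = 0 := by simp [qInt]

theorem qInt_succ (q m : ℕ) : qInt q (m + 1) = qInt q m + q ^ m := by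
  simp [qInt, sum_range_succ]

theorem qInt_one (q : ℕ) : qInt q 1 = 1 := by simp [qInt]

theorem qInt_add (q m k : ℕ) : qInt q (m + k) = qInt q m + q ^ m * qInt q k := by
  induction k with
  | zero => simp
  | succ k ih => rw [← add_assoc, qInt_succ, ih, qInt_succ, pow_add]; ring

theorem qInt_succ' (q m : ℕ) : qInt q (m + 1) = 1 + q * qInt q m := by
  rw [add_comm m 1, qInt_add, qInt_one, pow_one]

/-- The properties of the lattice `P(n,q)` on which the computation of its homology rests. They
treat `q = 1` (sets) and `q > 1` (subspaces) on an equal footing. In the sequel, an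
element `b ≤ a` with `rk b + 1 = rk a` is called a hyperplane of `a`. -/
structure IsQGeometry (n q : ℕ) (Q : Type*) [Lattice Q] : Prop where
  rk_lt : ∀ {x y : Q}, x < y → rk x < rk y
  rk_inf_add_rk_sup : ∀ x y : Q, rk (x ⊓ y) + rk (x ⊔ y) = rk x + rk y
  card_covers : ∀ {x a : Q}, x ≤ a →
    Nat.card {w : Q // x ≤ w ∧ w ≤ a ∧ rk w = rk x + 1} = qInt q (rk a - rk x)
  exists_top : ∃ a : Q, rk a = n ∧ ∀ x, x ≤ a
  self_dual : ∃ e : Q ≃o Qᵒᵈ, ∀ x, rk (OrderDual.ofDual (e x)) + rk x = n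

namespace IsQGeometry

variable {n q : ℕ} {Q : Type*} [Lattice Q]

theorem rk_le_rk (h : IsQGeometry n q Q) {x y : Q} (hxy : x ≤ y) : rk x ≤ rk y := by
  rcases hxy.lt_or_eq with hlt | rfl
  · exact (h.rk_lt hlt).le
  · exact le_rfl

theorem eq_of_le_of_rk_le (h : IsQGeometry n q Q)
    {x y : Q} (hxy : x ≤ y) (hr : rk y ≤ rk x) : x = y := by
  rcases hxy.lt_or_eq with hlt | rfl
  · exact absurd (h.rk_lt hlt) (by omega)
  · rfl

theorem rk_le (h : IsQGeometry n q Q) (x : Q) : rk x ≤ n := by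
  obtain ⟨e, he⟩ := h.self_dual
  have := he x
  omega

/-- The dual of `card_covers`, obtained through the anti-automorphism. -/
theorem card_cocovers (h : IsQGeometry n q Q) {x a : Q} (hxa : x ≤ a) :
    Nat.card {z : Q // x ≤ z ∧ z ≤ a ∧ rk z + 1 = rk a} = qInt q (rk a - rk x) := by
  obtain ⟨e, he⟩ := h.self_dual
  have hle : OrderDual.ofDual (e a) ≤ OrderDual.ofDual (e x) := by
    rw [OrderDual.ofDual_le_ofDual]
    exact e.monotone hxa
  have h1 := he a
  have h2 := he x
  have h3 := h.rk_le_rk hxa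
  have := h.card_covers hle
  rw [show rk (OrderDual.ofDual (e x)) - rk (OrderDual.ofDual (e a)) = rk a - rk x by omega] at this
  rw [← this]
  refine Nat.card_congr ((e.toEquiv.trans OrderDual.ofDual).subtypeEquiv fun z => ?_)
  have h4 := he z
  have h5 : x ≤ z ↔ OrderDual.ofDual (e z) ≤ OrderDual.ofDual (e x) := by
    rw [OrderDual.ofDual_le_ofDual, e.le_iff_le]
  have h6 : z ≤ a ↔ OrderDual.ofDual (e a) ≤ OrderDual.ofDual (e z) := by
    rw [OrderDual.ofDual_le_ofDual, e.le_iff_le]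
  simp only [Equiv.trans_apply, RelIso.coe_fn_toEquiv, ← h5, ← h6]
  constructor
  · rintro ⟨a1, a2, a3⟩; exact ⟨a2, a1, by omega⟩
  · rintro ⟨a1, a2, a3⟩; exact ⟨a2, a1, by omega⟩

/-- An element below `a` that is not below the hyperplane `b` of `a` meets `b` in a hyperplane. -/
theorem rk_inf_hyperplane (h : IsQGeometry n q Q)
    {a b w : Q} (hb : rk b + 1 = rk a) (hba : b ≤ a) (hwa : w ≤ a)
    (hwb : ¬ w ≤ b) : rk (w ⊓ b) + 1 = rk w := by
  have h1 := h.rk_inf_add_rk_sup w b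
  have h2 : rk (w ⊔ b) ≤ rk a := h.rk_le_rk (sup_le hwa hba)
  have h3 : rk b < rk (w ⊔ b) := h.rk_lt (right_lt_sup.2 hwb)
  omega

variable [Fintype Q]

open Classical in
theorem card_filter_covers (h : IsQGeometry n q Q) {x a : Q} (hxa : x ≤ a) :
    #{w : Q | x ≤ w ∧ w ≤ a ∧ rk w = rk x + 1} = qInt q (rk a - rk x) := by
  rw [← h.card_covers hxa, Nat.card_eq_fintype_card, Fintype.card_subtype]

open Classical in
theorem card_filter_cocovers (h : IsQGeometry n q Q) {x a : Q} (hxa : x ≤ a) :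
    #{z : Q | x ≤ z ∧ z ≤ a ∧ rk z + 1 = rk a} = qInt q (rk a - rk x) := by
  rw [← h.card_cocovers hxa, Nat.card_eq_fintype_card, Fintype.card_subtype]

theorem exists_cocover (h : IsQGeometry n q Q)
    {a : Q} (ha : 0 < rk a) : ∃ b ≤ a, rk b + 1 = rk a := by
  classical
  have h1 : 0 < Order.height a := by
    rw [pos_iff_ne_zero]
    intro h0
    rw [rk, h0] at ha
    simp at ha
  obtain ⟨x, hx⟩ : ∃ x, x < a := by
    by_contra! hcon
    have hmin : IsMin a := fun b hb => by
      rcases hb.lt_or_eq with hlt | rfl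
      · exact absurd hlt (hcon b)
      · exact le_rfl
    rw [Order.height_eq_zero.2 hmin] at h1
    exact lt_irrefl _ h1
  have h2 := h.card_filter_cocovers hx.le
  have h3 : 0 < qInt q (rk a - rk x) := by
    have := h.rk_lt hx
    obtain ⟨m, hm⟩ : ∃ m, rk a - rk x = m + 1 := ⟨rk a - rk x - 1, by omega⟩
    rw [hm, qInt_succ']
    omega
  rw [← h2, card_pos] at h3
  obtain ⟨z, hz⟩ := h3
  rw [mem_filter] at hz
  exact ⟨z, hz.2.2.1, hz.2.2.2⟩

open Classical in
/-- The number of covers of `x` below `a` that are not below the hyperplane `b` of `a`. -/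
theorem card_covers_not_le (h : IsQGeometry n q Q)
    {x a b : Q} (hb : rk b + 1 = rk a) (hba : b ≤ a) (hxb : x ≤ b) :
    #{w : Q | x ≤ w ∧ (w ≤ a ∧ ¬ w ≤ b) ∧ rk w = rk x + 1} = q ^ (rk b - rk x) := by
  have h1 := h.card_filter_covers (hxb.trans hba)
  have h2 := h.card_filter_covers hxb
  have h3 := h.rk_le_rk hxb
  rw [show rk a - rk x = rk b - rk x + 1 by omega, qInt_succ, ← h2] at h1
  have h4 := card_filter_add_card_filter_not (s := {w : Q | x ≤ w ∧ w ≤ a ∧ rk w = rk x + 1})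
    (fun w => w ≤ b)
  rw [h1, filter_filter, filter_filter] at h4
  have h5 : #{w : Q | (x ≤ w ∧ w ≤ a ∧ rk w = rk x + 1) ∧ w ≤ b} =
      #{w : Q | x ≤ w ∧ w ≤ b ∧ rk w = rk x + 1} := by
    congr 1; ext w
    simp only [mem_filter, mem_univ, true_and]
    constructor
    · rintro ⟨⟨a1, a2, a3⟩, a4⟩; exact ⟨a1, a4, a3⟩
    · rintro ⟨a1, a2, a3⟩; exact ⟨⟨a1, a2.trans hba, a3⟩, a2⟩
  rw [h5] at h4
  rw [← Nat.add_left_cancel h4]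
  congr 1; ext w
  simp only [mem_filter, mem_univ, true_and]
  tauto

open Classical in
/-- The number of elements that lie below `a` but not below the hyperplane `b`, and meet `b`
in `x`. -/
theorem card_inf_eq (h : IsQGeometry n q Q)
    {x a b : Q} (hb : rk b + 1 = rk a) (hba : b ≤ a) (hxb : x ≤ b) :
    #{w : Q | (w ≤ a ∧ ¬ w ≤ b) ∧ w ⊓ b = x} = q ^ (rk b - rk x) := by
  rw [← h.card_covers_not_le hb hba hxb]
  congr 1; ext w
  simp only [mem_filter, mem_univ, true_and]
  constructor
  · rintro ⟨⟨a1, a2⟩, rfl⟩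
    exact ⟨inf_le_left, ⟨a1, a2⟩, (h.rk_inf_hyperplane hb hba a1 a2).symm⟩
  · rintro ⟨a1, ⟨a2, a3⟩, a4⟩
    refine ⟨⟨a2, a3⟩, (h.eq_of_le_of_rk_le (le_inf a1 hxb) ?_).symm⟩
    have := h.rk_inf_hyperplane hb hba a2 a3
    omega

open Classical in
/-- The number of hyperplanes of `a` other than `b` that meet `b` in a given hyperplane of `b`. -/
theorem card_hyperplanes_inf_eq (h : IsQGeometry n q Q)
    {a b c : Q} (hb : rk b + 1 = rk a) (hba : b ≤ a)
    (hc : rk c + 1 = rk b) (hcb : c ≤ b) :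
    #{z : Q | (z ≤ a ∧ rk z + 1 = rk a ∧ z ≠ b) ∧ z ⊓ b = c} = q := by
  have := h.card_inf_eq hb hba hcb
  rw [show rk b - rk c = 1 by omega, pow_one] at this
  refine Eq.trans ?_ this
  congr 1; ext z
  simp only [mem_filter, mem_univ, true_and]
  constructor
  · rintro ⟨⟨a1, a2, a3⟩, a4⟩
    exact ⟨⟨a1, fun hzb => a3 (h.eq_of_le_of_rk_le hzb (by omega))⟩, a4⟩
  · rintro ⟨⟨a1, a2⟩, rfl⟩
    refine ⟨⟨a1, ?_, fun hzb => a2 hzb.le⟩, rfl⟩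
    have := h.rk_inf_hyperplane hb hba a1 a2
    omega

end IsQGeometry

/-! ### The incidence map on functions -/

section Operators

variable (F : Type*) [Field F] {Q : Type*}

open Classical in
/-- The incidence map `∂` on functions `Q → F`, where the function `f` stands for `∑ x, f x • x`. -/
def dn [PartialOrder Q] [Fintype Q] : (Q → F) →ₗ[F] (Q → F) where
  toFun f y := ∑ x with y ≤ x ∧ rk y + 1 = rk x, f x
  map_add' f g := by ext; simp [sum_add_distrib]
  map_smul' c f := by ext; simp [mul_sum]

open Classical in
theorem dn_apply [PartialOrder Q] [Fintype Q] (f : Q → F) (y : Q) :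
    dn F f y = ∑ x with y ≤ x ∧ rk y + 1 = rk x, f x := rfl

/-- The functions supported on the elements of rank `j` below `a`. -/
def chains [PartialOrder Q] (a : Q) (j : ℤ) : Submodule F (Q → F) where
  carrier := {f | ∀ x, f x ≠ 0 → x ≤ a ∧ (rk x : ℤ) = j}
  add_mem' {f g} hf hg x hx := by
    by_cases h : f x = 0
    · exact hg x fun h' => hx (by simp [h, h'])
    · exact hf x h
  zero_mem' x hx := by simp at hx
  smul_mem' c f hf x hx := hf x fun h => hx (by simp [h])

theorem mem_chains [PartialOrder Q] {a : Q} {j : ℤ} {f : Q → F} :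
    f ∈ chains F a j ↔ ∀ x, f x ≠ 0 → x ≤ a ∧ (rk x : ℤ) = j := Iff.rfl

variable {F} in
theorem eq_zero_of_mem_chains [PartialOrder Q] {a : Q} {j : ℤ} {f : Q → F}
    (hf : f ∈ chains F a j) {x : Q} (hx : ¬ x ≤ a) : f x = 0 := by
  by_contra h
  exact hx (hf x h).1

theorem chains_mono [PartialOrder Q] {a b : Q} (hab : a ≤ b) (j : ℤ) :
    chains F a j ≤ chains F b j :=
  fun _ hf x hx => ⟨(hf x hx).1.trans hab, (hf x hx).2⟩

variable [Lattice Q]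

open Classical in
/-- Let `b` be a hyperplane of an element above `z`, with `z` not below `b`. Then `lift` sends
`x ≤ z ⊓ b` to the average of those `w ≤ z` that meet `b` in `x` and are not below `b`; each of
them has rank `rk x + 1`, and there are `q ^ (rk z - rk w)` of them. -/
def lift (q : ℕ) (b z : Q) : (Q → F) →ₗ[F] (Q → F) where
  toFun f w := if w ≤ z ∧ ¬ w ≤ b then (q : F)⁻¹ ^ (rk z - rk w) * f (w ⊓ b) else 0
  map_add' f g := by
    ext
    simp only [Pi.add_apply]
    split_ifs
    · exact mul_add _ _ _
    · simp
  map_smul' c f := by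
    ext
    simp only [Pi.smul_apply, smul_eq_mul, RingHom.id_apply]
    split_ifs
    · exact mul_left_comm _ _ _
    · simp

open Classical in
theorem lift_apply (q : ℕ) (b z : Q) (f : Q → F) (w : Q) :
    lift F q b z f w = if w ≤ z ∧ ¬ w ≤ b then (q : F)⁻¹ ^ (rk z - rk w) * f (w ⊓ b) else 0 := rfl

theorem lift_apply_of (q : ℕ) (b : Q) {z : Q} (f : Q → F) {w : Q} (h1 : w ≤ z) (h2 : ¬ w ≤ b) :
    lift F q b z f w = (q : F)⁻¹ ^ (rk z - rk w) * f (w ⊓ b) := by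
  rw [lift_apply, if_pos ⟨h1, h2⟩]

theorem lift_apply_of_le (q : ℕ) {b : Q} (z : Q) (f : Q → F) {w : Q} (h : w ≤ b) :
    lift F q b z f w = 0 := by
  rw [lift_apply, if_neg (by tauto)]

theorem lift_apply_of_not_le (q : ℕ) (b : Q) {z : Q} (f : Q → F) {w : Q} (h : ¬ w ≤ z) :
    lift F q b z f w = 0 := by
  rw [lift_apply, if_neg (by tauto)]

variable [Fintype Q]

open Classical in
/-- The linear map sending `w` to `w ⊓ b` if `w ≤ z` and `w` is not below `b`, and to `0`
otherwise. -/
def proj (b z : Q) : (Q → F) →ₗ[F] (Q → F) where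
  toFun f x := ∑ w with (w ≤ z ∧ ¬ w ≤ b) ∧ w ⊓ b = x, f w
  map_add' f g := by ext; simp [sum_add_distrib]
  map_smul' c f := by ext; simp [mul_sum]

open Classical in
theorem proj_apply (b z : Q) (f : Q → F) (x : Q) :
    proj F b z f x = ∑ w with (w ≤ z ∧ ¬ w ≤ b) ∧ w ⊓ b = x, f w := rfl

open Classical in
/-- The defect of commutation of `∂` and `proj b z`, where `c = z ⊓ b`. -/
def defect (b c : Q) : (Q → F) →ₗ[F] (Q → F) where
  toFun f x := ∑ w with (¬ w ≤ b ∧ ¬ w ⊓ b ≤ c) ∧ w ⊓ c = x, f w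
  map_add' f g := by ext; simp [sum_add_distrib]
  map_smul' c f := by ext; simp [mul_sum]

open Classical in
theorem defect_apply (b c : Q) (f : Q → F) (x : Q) :
    defect F b c f x = ∑ w with (¬ w ≤ b ∧ ¬ w ⊓ b ≤ c) ∧ w ⊓ c = x, f w := rfl

end Operators

/-! ### Commutation relations -/

section Relations

variable {F : Type*} [Field F] {Q : Type*}

theorem dn_mem [PartialOrder Q] [Fintype Q] {a : Q} {j : ℤ} {f : Q → F} (hf : f ∈ chains F a j) :
    dn F f ∈ chains F a (j - 1) := by
  classical
  intro y hy
  rw [dn_apply] at hy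
  obtain ⟨x, hx, hfx⟩ := exists_ne_zero_of_sum_ne_zero hy
  rw [mem_filter] at hx
  obtain ⟨h1, h2⟩ := hf x hfx
  exact ⟨hx.2.1.trans h1, by omega⟩

theorem dn_pow_mem [PartialOrder Q] [Fintype Q] {a : Q} {j : ℤ} {f : Q → F}
    (hf : f ∈ chains F a j) (i : ℕ) : (dn F ^ i) f ∈ chains F a (j - i) := by
  induction i with
  | zero => simpa using hf
  | succ i ih =>
    rw [pow_succ', Module.End.mul_apply]
    convert dn_mem ih using 2
    push_cast; ring

variable [Lattice Q] {n q : ℕ}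

theorem lift_mem (h : IsQGeometry n q Q) {a b z : Q} (hb : rk b + 1 = rk a) (hba : b ≤ a)
    (hza : z ≤ a) {c : Q} {j : ℤ} {f : Q → F} (hf : f ∈ chains F c j) :
    lift F q b z f ∈ chains F a (j + 1) := by
  intro w hw
  rw [lift_apply] at hw
  split_ifs at hw with h1
  · have h2 := hf _ (right_ne_zero_of_mul hw)
    have h3 := h.rk_inf_hyperplane hb hba (h1.1.trans hza) h1.2
    exact ⟨h1.1.trans hza, by omega⟩
  · exact absurd rfl hw

variable [Fintype Q]

theorem proj_mem (h : IsQGeometry n q Q) {a b z : Q} (hb : rk b + 1 = rk a) (hba : b ≤ a)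
    (hza : z ≤ a) {j : ℤ} {f : Q → F} (hf : f ∈ chains F a j) :
    proj F b z f ∈ chains F (z ⊓ b) (j - 1) := by
  classical
  intro x hx
  rw [proj_apply] at hx
  obtain ⟨w, hw, hfw⟩ := exists_ne_zero_of_sum_ne_zero hx
  rw [mem_filter] at hw
  obtain ⟨-, ⟨h1, h2⟩, rfl⟩ := hw
  have h3 := h.rk_inf_hyperplane hb hba (h1.trans hza) h2
  have h4 := hf w hfw
  exact ⟨inf_le_inf_right b h1, by omega⟩

/-- The lift satisfies a twisted Leibniz rule: a lifted element has one face in the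
hyperplane `b`, namely the element itself, and the other faces are lifts of its faces, each arising
`q` times on average. -/
theorem dn_lift (h : IsQGeometry n q Q) (hq : (q : F) ≠ 0) {a b z : Q} (hb : rk b + 1 = rk a)
    (hba : b ≤ a) (hza : z ≤ a) (hzb : ¬ z ≤ b) {j : ℤ} {f : Q → F}
    (hf : f ∈ chains F (z ⊓ b) j) :
    dn F (lift F q b z f) = f + (q : F) • lift F q b z (dn F f) := by
  classical
  have hzr := h.rk_inf_hyperplane hb hba hza hzb
  ext y
  rw [dn_apply, Pi.add_apply, Pi.smul_apply, smul_eq_mul]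
  by_cases hyz : y ≤ z
  swap
  · rw [lift_apply_of_not_le F q b _ hyz, mul_zero, add_zero,
      eq_zero_of_mem_chains hf fun hy => hyz (hy.trans inf_le_left)]
    refine sum_eq_zero fun w hw => ?_
    rw [mem_filter] at hw
    exact lift_apply_of_not_le F q b _ fun hwz => hyz (hw.2.1.trans hwz)
  by_cases hyb : y ≤ b
  · rw [lift_apply_of_le F q z _ hyb, mul_zero, add_zero]
    have hyzb := le_inf hyz hyb
    have hcount := h.card_covers_not_le hzr inf_le_left hyzb
    have hsub : ∀ w ∈ ({w | y ≤ w ∧ rk y + 1 = rk w} : Finset Q),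
        w ∉ ({w | y ≤ w ∧ (w ≤ z ∧ ¬ w ≤ z ⊓ b) ∧ rk w = rk y + 1} : Finset Q) →
        lift F q b z f w = 0 := by
      intro w hw hw'
      simp only [mem_filter, mem_univ, true_and] at hw hw'
      rw [lift_apply, if_neg]
      rintro ⟨h1, h2⟩
      exact hw' ⟨hw.1, ⟨h1, fun h3 => h2 (h3.trans inf_le_right)⟩, hw.2.symm⟩
    rw [← sum_subset _ hsub]
    · rw [sum_congr rfl (g := fun _ => (q : F)⁻¹ ^ (rk (z ⊓ b) - rk y) * f y), sum_const, hcount,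
        nsmul_eq_mul, Nat.cast_pow, ← mul_assoc, ← mul_pow, mul_inv_cancel₀ hq, one_pow, one_mul]
      intro w hw
      simp only [mem_filter, mem_univ, true_and] at hw
      obtain ⟨h1, ⟨h2, h3⟩, h4⟩ := hw
      have h5 : ¬ w ≤ b := fun h6 => h3 (le_inf h2 h6)
      have h6 := h.rk_inf_hyperplane hb hba (h2.trans hza) h5
      rw [lift_apply_of F q b _ h2 h5, ← h.eq_of_le_of_rk_le (le_inf h1 hyb) (by omega)]
      congr 2
      omega
    · intro w hw
      simp only [mem_filter, mem_univ, true_and] at hw ⊢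
      exact ⟨hw.1, hw.2.2.symm⟩
  · rw [eq_zero_of_mem_chains hf fun hy => hyb (hy.trans inf_le_right), zero_add,
      lift_apply_of F q b _ hyz hyb, dn_apply]
    have hyr := h.rk_inf_hyperplane hb hba (hyz.trans hza) hyb
    -- The covers of `y` below `z` correspond to those of `y ⊓ b` below `z ⊓ b`.
    have h1 : ∑ w with y ≤ w ∧ rk y + 1 = rk w, lift F q b z f w =
        ∑ w with (y ≤ w ∧ rk y + 1 = rk w) ∧ w ≤ z, lift F q b z f w := by
      rw [← filter_filter (fun w => y ≤ w ∧ rk y + 1 = rk w)]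
      symm
      apply sum_filter_of_ne
      intro w hw hne
      by_contra hcon
      exact hne (lift_apply_of_not_le F q b _ hcon)
    have h2 : ∑ x with y ⊓ b ≤ x ∧ rk (y ⊓ b) + 1 = rk x, f x =
        ∑ x with (y ⊓ b ≤ x ∧ rk (y ⊓ b) + 1 = rk x) ∧ x ≤ z ⊓ b, f x := by
      rw [← filter_filter (fun x => y ⊓ b ≤ x ∧ rk (y ⊓ b) + 1 = rk x)]
      symm
      apply sum_filter_of_ne
      intro x hx hne
      exact (hf x hne).1
    rw [h1, h2, mul_sum, mul_sum]
    refine sum_bij' (fun w _ => w ⊓ b) (fun x _ => x ⊔ y) ?_ ?_ ?_ ?_ ?_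
    · intro w hw
      simp only [mem_filter, mem_univ, true_and] at hw ⊢
      obtain ⟨⟨a1, a2⟩, a3⟩ := hw
      have a4 := h.rk_inf_hyperplane hb hba (a3.trans hza) fun hwb => hyb (a1.trans hwb)
      exact ⟨⟨inf_le_inf_right b a1, by omega⟩, inf_le_inf_right b a3⟩
    · intro x hx
      simp only [mem_filter, mem_univ, true_and] at hx ⊢
      obtain ⟨⟨a1, a2⟩, a3⟩ := hx
      have a4 : x ⊓ y = y ⊓ b :=
        le_antisymm (le_inf inf_le_right (inf_le_left.trans (a3.trans inf_le_right)))
          (le_inf a1 inf_le_left)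
      have a5 := h.rk_inf_add_rk_sup x y
      rw [a4] at a5
      exact ⟨⟨le_sup_right, by omega⟩, sup_le (a3.trans inf_le_left) hyz⟩
    · intro w hw
      simp only [mem_filter, mem_univ, true_and] at hw
      obtain ⟨⟨a1, a2⟩, a3⟩ := hw
      have a4 := h.rk_inf_hyperplane hb hba (a3.trans hza) fun hwb => hyb (a1.trans hwb)
      refine h.eq_of_le_of_rk_le (sup_le inf_le_left a1) ?_
      have a5 := h.rk_inf_add_rk_sup (w ⊓ b) y
      have a6 : rk (w ⊓ b ⊓ y) ≤ rk (y ⊓ b) :=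
        h.rk_le_rk (le_inf inf_le_right (inf_le_left.trans inf_le_right))
      omega
    · intro x hx
      simp only [mem_filter, mem_univ, true_and] at hx
      obtain ⟨⟨a1, a2⟩, a3⟩ := hx
      have a4 : x ≤ (x ⊔ y) ⊓ b := le_inf le_sup_left (a3.trans inf_le_right)
      refine (h.eq_of_le_of_rk_le a4 ?_).symm
      have a5 := h.rk_inf_hyperplane hb hba ((sup_le (a3.trans inf_le_left) hyz).trans hza)
        (fun hxy => hyb (le_sup_right.trans hxy))
      have a6 := h.rk_inf_add_rk_sup x y
      have a7 : rk (y ⊓ b) ≤ rk (x ⊓ y) := h.rk_le_rk (le_inf a1 inf_le_left)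
      omega
    · intro w hw
      simp only [mem_filter, mem_univ, true_and] at hw
      obtain ⟨⟨a1, a2⟩, a3⟩ := hw
      rw [lift_apply_of F q b _ a3 fun hwb => hyb (a1.trans hwb), ← mul_assoc]
      congr 1
      have a4 := h.rk_le_rk a3
      rw [show rk z - rk y = rk z - rk w + 1 by omega, pow_succ', ← mul_assoc,
        mul_inv_cancel₀ hq, one_mul]

/-- Up to the factor `q`, the projection commutes with `∂` except for a defect that depends on
`z ⊓ b` only. -/
theorem proj_dn (h : IsQGeometry n q Q) {a b z : Q} (hb : rk b + 1 = rk a)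
    (hba : b ≤ a) (hza : z ≤ a) (hz : rk z + 1 = rk a) (hzb : z ≠ b) {j : ℤ} {f : Q → F}
    (hf : f ∈ chains F a j) :
    proj F b z (dn F f) = (q : F) • dn F (proj F b z f) + defect F b (z ⊓ b) f := by
  classical
  have hzb' : ¬ z ≤ b := fun hle => hzb (h.eq_of_le_of_rk_le hle (by omega))
  ext x
  rw [proj_apply, Pi.add_apply, Pi.smul_apply, smul_eq_mul, dn_apply, defect_apply]
  -- All three terms are combinations of the `f w`; the coefficients are compared.
  have e1 : ∑ y with (y ≤ z ∧ ¬ y ≤ b) ∧ y ⊓ b = x, dn F f y = ∑ w, f w *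
      (#{y | ((y ≤ z ∧ ¬ y ≤ b) ∧ y ⊓ b = x) ∧ (y ≤ w ∧ rk y + 1 = rk w)} : ℕ) := by
    simp only [dn_apply]
    rw [sum_comm' (t' := univ) (s' := fun w =>
      {y | ((y ≤ z ∧ ¬ y ≤ b) ∧ y ⊓ b = x) ∧ (y ≤ w ∧ rk y + 1 = rk w)}) (by simp)]
    simp [mul_comm]
  have e2 : ∑ x' with x ≤ x' ∧ rk x + 1 = rk x', proj F b z f x' = ∑ w, f w *
      (if (w ≤ z ∧ ¬ w ≤ b) ∧ (x ≤ w ⊓ b ∧ rk x + 1 = rk (w ⊓ b)) then 1 else 0) := by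
    simp only [proj_apply]
    rw [sum_comm' (t' := {w | (w ≤ z ∧ ¬ w ≤ b) ∧ (x ≤ w ⊓ b ∧ rk x + 1 = rk (w ⊓ b))})
      (s' := fun w => {w ⊓ b})]
    · simp [sum_filter]
    · intro x' w
      simp only [mem_filter, mem_univ, true_and, mem_singleton]
      constructor
      · rintro ⟨a1, a2, rfl⟩; exact ⟨rfl, a2, a1⟩
      · rintro ⟨rfl, a2, a1⟩; exact ⟨a1, a2, rfl⟩
  have e3 : ∑ w with (¬ w ≤ b ∧ ¬ w ⊓ b ≤ z ⊓ b) ∧ w ⊓ (z ⊓ b) = x, f w = ∑ w, f w *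
      (if (¬ w ≤ b ∧ ¬ w ⊓ b ≤ z ⊓ b) ∧ w ⊓ (z ⊓ b) = x then 1 else 0) := by
    simp [sum_filter]
  rw [e1, e2, e3, mul_sum, ← sum_add_distrib]
  refine sum_congr rfl fun w _ => ?_
  by_cases hfw : f w = 0
  · simp [hfw]
  have hwa := (hf w hfw).1
  rw [mul_left_comm, ← mul_add]
  congr 1
  by_cases hwb : w ≤ b
  · rw [if_neg (by tauto), if_neg (by tauto), card_eq_zero.2]
    · simp
    · refine filter_false_of_mem fun y _ => ?_
      rintro ⟨⟨⟨-, a1⟩, -⟩, a2, -⟩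
      exact a1 (a2.trans hwb)
  have hwr := h.rk_inf_hyperplane hb hba hwa hwb
  by_cases hwz : w ≤ z
  · rw [if_neg (c := (¬ w ≤ b ∧ ¬ w ⊓ b ≤ z ⊓ b) ∧ w ⊓ (z ⊓ b) = x)
      (fun hc => hc.1.2 (inf_le_inf_right b hwz)), add_zero]
    by_cases hx : x ≤ w ⊓ b ∧ rk x + 1 = rk (w ⊓ b)
    · rw [if_pos ⟨⟨hwz, hwb⟩, hx⟩, mul_one]
      congr 1
      have := h.card_hyperplanes_inf_eq hwr inf_le_left hx.2 hx.1
      refine Eq.trans ?_ this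
      congr 1; ext y
      simp only [mem_filter, mem_univ, true_and]
      constructor
      · rintro ⟨⟨⟨a1, a2⟩, a3⟩, a4, a5⟩
        refine ⟨⟨a4, a5, fun hy => a2 (hy.le.trans inf_le_right)⟩, ?_⟩
        rw [← inf_assoc, inf_eq_left.2 a4, a3]
      · rintro ⟨⟨a1, a2, a3⟩, a4⟩
        rw [← inf_assoc, inf_eq_left.2 a1] at a4
        refine ⟨⟨⟨a1.trans hwz, fun hy => a3 ?_⟩, a4⟩, a1, a2⟩
        exact h.eq_of_le_of_rk_le (le_inf a1 hy) (by omega)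
    · rw [if_neg (by tauto), card_eq_zero.2]
      · simp
      · refine filter_false_of_mem fun y _ => ?_
        rintro ⟨⟨⟨a1, a2⟩, rfl⟩, a4, a5⟩
        have := h.rk_inf_hyperplane hb hba (a4.trans hwa) a2
        exact hx ⟨inf_le_inf_right b a4, by omega⟩
  · -- The only face of `w` below `z` is `w ⊓ z`.
    have hwzr := h.rk_inf_hyperplane hz hza hwa hwz
    rw [if_neg (c := (w ≤ z ∧ ¬ w ≤ b) ∧ (x ≤ w ⊓ b ∧ rk x + 1 = rk (w ⊓ b))) (by tauto),
      mul_zero, zero_add]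
    have hiff : ¬ w ⊓ z ≤ b ↔ ¬ w ⊓ b ≤ z ⊓ b := by
      rw [not_iff_not]
      constructor
      · intro hle
        have := h.eq_of_le_of_rk_le (le_inf inf_le_left hle : w ⊓ z ≤ w ⊓ b) (by omega)
        exact le_inf (this ▸ inf_le_right) inf_le_right
      · intro hle
        have := h.eq_of_le_of_rk_le
          (le_inf inf_le_left (hle.trans inf_le_left) : w ⊓ b ≤ w ⊓ z) (by omega)
        exact this ▸ inf_le_right
    have hset : ∀ y, (((y ≤ z ∧ ¬ y ≤ b) ∧ y ⊓ b = x) ∧ (y ≤ w ∧ rk y + 1 = rk w)) ↔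
        y = w ⊓ z ∧ (¬ w ≤ b ∧ ¬ w ⊓ b ≤ z ⊓ b) ∧ w ⊓ (z ⊓ b) = x := by
      intro y
      rw [← hiff, ← inf_assoc]
      constructor
      · rintro ⟨⟨⟨a1, a2⟩, a3⟩, a4, a5⟩
        have := h.eq_of_le_of_rk_le (le_inf a4 a1) (by omega)
        subst this
        exact ⟨rfl, ⟨hwb, a2⟩, a3⟩
      · rintro ⟨rfl, ⟨a1, a2⟩, a3⟩
        exact ⟨⟨⟨inf_le_right, a2⟩, a3⟩, inf_le_left, hwzr⟩
    simp_rw [hset]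
    split_ifs with hc
    · rw [card_eq_one.2 ⟨w ⊓ z, by
        ext y
        simp only [mem_filter, mem_univ, true_and, mem_singleton]
        exact and_iff_left hc⟩, Nat.cast_one]
    · rw [card_eq_zero.2 (filter_false_of_mem fun y _ hy => hc hy.2), Nat.cast_zero]

end Relations

/-! ### Decomposition of chains along a hyperplane -/

section Restriction

variable {F : Type*} [Field F] {Q : Type*} [PartialOrder Q]

open Classical in
/-- The part of `f` supported on the elements below `b`. -/
def restr (b : Q) (f : Q → F) (x : Q) : F := if x ≤ b then f x else 0

theorem restr_mem {a b : Q} {j : ℤ} {f : Q → F} (hf : f ∈ chains F a j) :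
    restr b f ∈ chains F b j := by
  intro x hx
  rw [restr] at hx
  split_ifs at hx with hxb
  · exact ⟨hxb, (hf x hx).2⟩
  · exact absurd rfl hx

end Restriction

section Decomposition

variable {F : Type*} [Field F] {Q : Type*} [Lattice Q] [Fintype Q] {n q : ℕ}

open Classical in
/-- The hyperplanes of `a` other than `b`. -/
def otherHyperplanes (a b : Q) : Finset Q := {z | z ≤ a ∧ rk z + 1 = rk a ∧ z ≠ b}

theorem mem_otherHyperplanes {a b z : Q} :
    z ∈ otherHyperplanes a b ↔ z ≤ a ∧ rk z + 1 = rk a ∧ z ≠ b := by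
  simp [otherHyperplanes]

theorem not_le_of_mem_otherHyperplanes (h : IsQGeometry n q Q) {a b z : Q} (hb : rk b + 1 = rk a)
    (hz : z ∈ otherHyperplanes a b) : ¬ z ≤ b := by
  rw [mem_otherHyperplanes] at hz
  exact fun hle => hz.2.2 (h.eq_of_le_of_rk_le hle (by omega))

open Classical in
/-- The number of hyperplanes of `a` above an element `x` not below `b`. -/
theorem card_otherHyperplanes_ge (h : IsQGeometry n q Q) {a b x : Q} (hxa : x ≤ a)
    (hxb : ¬ x ≤ b) : #{z ∈ otherHyperplanes a b | x ≤ z} = qInt q (rk a - rk x) := by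
  rw [← h.card_filter_cocovers hxa]
  congr 1; ext z
  simp only [mem_filter, mem_otherHyperplanes, mem_univ, true_and]
  constructor
  · rintro ⟨⟨a1, a2, a3⟩, a4⟩; exact ⟨a4, a1, a2⟩
  · rintro ⟨a1, a2, a3⟩
    exact ⟨⟨a2, a3, fun hzb => hxb (hzb ▸ a1)⟩, a1⟩

open Classical in
/-- The averages over the `q` hyperplanes of `a` through `c` other than `b` add up to `q` times the
average over `a`. -/
theorem sum_lift_sub_lift (h : IsQGeometry n q Q) (hq : (q : F) ≠ 0) {a b c : Q}
    (hb : rk b + 1 = rk a) (hba : b ≤ a) (hc : rk c + 1 = rk b) (hcb : c ≤ b) {j : ℤ} {g : Q → F}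
    (hg : g ∈ chains F c j) :
    ∑ z ∈ otherHyperplanes a b with z ⊓ b = c, (lift F q b z g - lift F q b a g) = 0 := by
  have hcard : #{z ∈ otherHyperplanes a b | z ⊓ b = c} = q := by
    rw [← h.card_hyperplanes_inf_eq hb hba hc hcb]
    congr 1; ext z
    simp only [mem_filter, mem_otherHyperplanes, mem_univ, true_and]
  rw [sum_sub_distrib, sum_const, hcard, sub_eq_zero]
  ext w
  rw [Finset.sum_apply, Pi.smul_apply, nsmul_eq_mul]
  by_cases hwb : w ≤ b
  · rw [lift_apply_of_le F q a g hwb, mul_zero]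
    exact sum_eq_zero fun z _ => lift_apply_of_le F q z g hwb
  by_cases hwa : w ≤ a
  swap
  · rw [lift_apply_of_not_le F q b g hwa, mul_zero]
    refine sum_eq_zero fun z hz => lift_apply_of_not_le F q b g fun hwz => hwa ?_
    rw [mem_filter, mem_otherHyperplanes] at hz
    exact hwz.trans hz.1.1
  have hwr := h.rk_inf_hyperplane hb hba hwa hwb
  by_cases hwc : w ⊓ b ≤ c
  swap
  · rw [lift_apply_of F q b g hwa hwb, eq_zero_of_mem_chains hg hwc, mul_zero, mul_zero]
    refine sum_eq_zero fun z hz => ?_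
    rw [lift_apply, eq_zero_of_mem_chains hg hwc, mul_zero, ite_self]
  -- Only the hyperplane `w ⊔ c` contributes.
  have hwc' : w ⊓ c = w ⊓ b :=
    le_antisymm (inf_le_inf_left w hcb) (le_inf inf_le_left hwc)
  have hrk := h.rk_inf_add_rk_sup w c
  rw [hwc'] at hrk
  have hwca : w ⊔ c ≤ a := sup_le hwa (hcb.trans hba)
  have hwcb : ¬ w ⊔ c ≤ b := fun hle => hwb (le_sup_left.trans hle)
  have hmem : w ⊔ c ∈ {z ∈ otherHyperplanes a b | z ⊓ b = c} := by
    rw [mem_filter, mem_otherHyperplanes]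
    refine ⟨⟨hwca, by omega, fun hle => hwcb hle.le⟩, ?_⟩
    have := h.rk_inf_hyperplane hb hba hwca hwcb
    exact (h.eq_of_le_of_rk_le (le_inf le_sup_right hcb) (by omega)).symm
  rw [sum_eq_single_of_mem _ hmem]
  · rw [lift_apply_of F q b g le_sup_left hwb, lift_apply_of F q b g hwa hwb, ← mul_assoc]
    congr 1
    have := h.rk_le_rk (le_sup_left : w ≤ w ⊔ c)
    rw [show rk a - rk w = rk (w ⊔ c) - rk w + 1 by omega, pow_succ', ← mul_assoc,
      mul_inv_cancel₀ hq, one_mul]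
  · intro z hz hne
    rw [mem_filter, mem_otherHyperplanes] at hz
    refine lift_apply_of_not_le F q b g fun hwz => hne ?_
    refine (h.eq_of_le_of_rk_le (sup_le hwz ?_) (by omega)).symm
    rw [← hz.2]
    exact inf_le_left

/-- A chain below `a` is the sum of a chain below the hyperplane `b`, a lift of a chain below `b`,
and differences of lifts of chains below hyperplanes of `b`. This stands in for the decomposition
of a chain into its components for the characters of the group of elations with axis `b`. -/
theorem chain_decomposition (h : IsQGeometry n q Q) (hq : (q : F) ≠ 0) {a b : Q}
    (hb : rk b + 1 = rk a) (hba : b ≤ a) {j : ℤ} {f : Q → F} (hf : f ∈ chains F a j) :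
    f = restr b f + lift F q b a (proj F b a f) +
      ∑ z ∈ otherHyperplanes a b, (lift F q b z (proj F b z f) - lift F q b a (proj F b z f)) := by
  classical
  ext w
  rw [Pi.add_apply, Pi.add_apply, Finset.sum_apply, restr]
  simp only [Pi.sub_apply]
  by_cases hwb : w ≤ b
  · rw [if_pos hwb, lift_apply_of_le F q a _ hwb, sum_eq_zero, add_zero, add_zero]
    intro z _
    rw [lift_apply_of_le F q a _ hwb, lift_apply_of_le F q z _ hwb, sub_zero]
  rw [if_neg hwb, zero_add]
  by_cases hwa : w ≤ a
  swap
  · rw [lift_apply_of_not_le F q b _ hwa, sum_eq_zero, add_zero, eq_zero_of_mem_chains hf hwa]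
    intro z hz
    rw [mem_otherHyperplanes] at hz
    rw [lift_apply_of_not_le F q b _ hwa,
      lift_apply_of_not_le F q b _ fun hwz => hwa (hwz.trans hz.1), sub_zero]
  have hwr := h.rk_inf_hyperplane hb hba hwa hwb
  have hwa' := h.rk_le_rk hwa
  set m := rk a - rk w with hm
  set S : Finset Q := {x | (x ≤ a ∧ ¬ x ≤ b) ∧ x ⊓ b = w ⊓ b} with hS
  have hterm : ∀ z ∈ otherHyperplanes a b,
      lift F q b z (proj F b z f) w - lift F q b a (proj F b z f) w =
      ∑ x ∈ S, (q : F)⁻¹ ^ m *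
        (f x * if x ≤ z then ((q : F) * (if w ≤ z then 1 else 0) - 1) else 0) := by
    intro z hz
    rw [mem_otherHyperplanes] at hz
    have h1 : proj F b z f (w ⊓ b) = ∑ x ∈ S, if x ≤ z then f x else 0 := by
      rw [proj_apply, ← sum_filter, hS, filter_filter]
      congr 1; ext x
      simp only [mem_filter, mem_univ, true_and]
      constructor
      · rintro ⟨⟨a1, a2⟩, a3⟩; exact ⟨⟨⟨a1.trans hz.1, a2⟩, a3⟩, a1⟩
      · rintro ⟨⟨⟨a1, a2⟩, a3⟩, a4⟩; exact ⟨⟨a4, a2⟩, a3⟩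
    have h2 : lift F q b z (proj F b z f) w =
        (q : F)⁻¹ ^ m * (q * (if w ≤ z then 1 else 0)) * proj F b z f (w ⊓ b) := by
      by_cases hwz : w ≤ z
      · rw [lift_apply_of F q b _ hwz hwb, if_pos hwz, mul_one]
        congr 1
        have := h.rk_le_rk hwz
        rw [hm, show rk a - rk w = rk z - rk w + 1 by omega, pow_succ, mul_assoc,
          inv_mul_cancel₀ hq, mul_one]
      · rw [lift_apply_of_not_le F q b _ hwz, if_neg hwz]
        simp
    rw [h2, lift_apply_of F q b _ hwa hwb, h1, mul_sum, mul_sum, ← sum_sub_distrib]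
    refine sum_congr rfl fun x _ => ?_
    by_cases hxz : x ≤ z
    · simp only [if_pos hxz, ← hm]; ring
    · simp only [if_neg hxz]; ring
  rw [sum_congr rfl hterm, sum_comm, lift_apply_of F q b _ hwa hwb, proj_apply, ← hS, ← hm,
    mul_sum, ← sum_add_distrib]
  have hcoef : ∀ x ∈ S, (q : F)⁻¹ ^ m * f x + ∑ z ∈ otherHyperplanes a b,
      (q : F)⁻¹ ^ m * (f x * if x ≤ z then ((q : F) * (if w ≤ z then 1 else 0) - 1) else 0) =
      if x = w then f x else 0 := by
    intro x hx
    rw [hS, mem_filter] at hx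
    obtain ⟨-, ⟨hxa, hxb⟩, hxw⟩ := hx
    have hxr := h.rk_inf_hyperplane hb hba hxa hxb
    rw [hxw] at hxr
    have h1 : ∑ z ∈ otherHyperplanes a b,
        (if x ≤ z then ((q : F) * (if w ≤ z then 1 else 0) - 1) else 0) =
        q * (qInt q (rk a - rk (x ⊔ w)) : ℕ) - (qInt q m : ℕ) := by
      rw [← card_otherHyperplanes_ge h (b := b) (sup_le hxa hwa)
        (fun hle => hxb (le_sup_left.trans hle)), hm, show rk w = rk x by omega,
        ← card_otherHyperplanes_ge h hxa hxb, ← sum_filter, sum_sub_distrib, ← mul_sum,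
        ← sum_filter, filter_filter]
      simp [sup_le_iff]
    rw [← mul_sum, ← mul_sum, h1, ← mul_add]
    have h2 : ((qInt q m : ℕ) : F) + (q : F) ^ m = 1 + q * (qInt q m : ℕ) := by
      have := congrArg (Nat.cast : ℕ → F) ((qInt_succ q m).symm.trans (qInt_succ' q m))
      push_cast at this
      exact this
    by_cases hxw' : x = w
    · rw [if_pos hxw', hxw', sup_idem, ← hm,
        show f w + f w * (q * (qInt q m : ℕ) - (qInt q m : ℕ)) =
          (1 + q * (qInt q m : ℕ) - (qInt q m : ℕ)) * f w by ring, ← h2, add_sub_cancel_left,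
        ← mul_assoc, ← mul_pow, inv_mul_cancel₀ hq, one_pow, one_mul]
    · have h3 := h.rk_inf_add_rk_sup x w
      have h4 : rk (w ⊓ b) ≤ rk (x ⊓ w) :=
        h.rk_le_rk (le_inf (by rw [← hxw]; exact inf_le_left) inf_le_left)
      have h5 : rk (x ⊓ w) < rk x := by
        refine h.rk_lt (lt_of_le_of_ne inf_le_left fun heq => hxw' ?_)
        exact h.eq_of_le_of_rk_le (inf_eq_left.1 heq) (by omega)
      have h6 := h.rk_le_rk (sup_le hxa hwa)
      have h7 : ((qInt q m : ℕ) : F) = 1 + q * (qInt q (rk a - rk (x ⊔ w)) : ℕ) := by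
        rw [hm, show rk a - rk w = rk a - rk (x ⊔ w) + 1 by omega, qInt_succ']
        push_cast; ring
      rw [if_neg hxw', h7]
      ring
  rw [sum_congr rfl hcoef, sum_ite_eq' S w f, if_pos]
  rw [hS, mem_filter]
  exact ⟨mem_univ _, ⟨hwa, hwb⟩, rfl⟩

end Decomposition

/-! ### Exactness -/

section Exactness

variable {F : Type*} [Field F] {Q : Type*} [Lattice Q] [Fintype Q] {n q : ℕ}

theorem dn_pow_lift (h : IsQGeometry n q Q) (hq : (q : F) ≠ 0) {a b z : Q} (hb : rk b + 1 = rk a)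
    (hba : b ≤ a) (hza : z ≤ a) (hzb : ¬ z ≤ b) {j : ℤ} {f : Q → F}
    (hf : f ∈ chains F (z ⊓ b) j) (i : ℕ) :
    (dn F ^ (i + 1)) (lift F q b z f) = ((qInt q (i + 1) : ℕ) : F) • (dn F ^ i) f +
      (q : F) ^ (i + 1) • lift F q b z ((dn F ^ (i + 1)) f) := by
  induction i with
  | zero => simp [qInt_one, dn_lift h hq hb hba hza hzb hf]
  | succ i ih =>
    rw [pow_succ', Module.End.mul_apply, ih, map_add, map_smul, map_smul,
      dn_lift h hq hb hba hza hzb (dn_pow_mem hf (i + 1)), qInt_succ q (i + 1)]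
    simp only [← Module.End.mul_apply, ← pow_succ']
    push_cast
    module

theorem dn_pow_lift_sub_lift (h : IsQGeometry n q Q) (hq : (q : F) ≠ 0) {a b z : Q}
    (hb : rk b + 1 = rk a) (hba : b ≤ a) (hz : z ∈ otherHyperplanes a b) {j : ℤ} {f : Q → F}
    (hf : f ∈ chains F (z ⊓ b) j) (i : ℕ) :
    (dn F ^ i) (lift F q b z f - lift F q b a f) =
      (q : F) ^ i • (lift F q b z ((dn F ^ i) f) - lift F q b a ((dn F ^ i) f)) := by
  have hzb := not_le_of_mem_otherHyperplanes h hb hz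
  rw [mem_otherHyperplanes] at hz
  have hab : ¬ a ≤ b := fun hle => hzb (hz.1.trans hle)
  have hf' : f ∈ chains F (a ⊓ b) j := chains_mono F (inf_le_inf_right b hz.1) j hf
  rcases i with _ | i
  · simp
  · rw [map_sub, dn_pow_lift h hq hb hba hz.1 hzb hf i, dn_pow_lift h hq hb hba le_rfl hab hf' i]
    module

/-- The defect of commutation cancels in the difference of two projections. -/
theorem proj_dn_pow_sub (h : IsQGeometry n q Q) {a b z z' : Q} (hb : rk b + 1 = rk a)
    (hba : b ≤ a) (hz : z ∈ otherHyperplanes a b) (hz' : z' ∈ otherHyperplanes a b)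
    (hzz' : z ⊓ b = z' ⊓ b) {j : ℤ} {f : Q → F} (hf : f ∈ chains F a j) (i : ℕ) :
    proj F b z ((dn F ^ i) f) - proj F b z' ((dn F ^ i) f) =
      (q : F) ^ i • (dn F ^ i) (proj F b z f - proj F b z' f) := by
  rw [mem_otherHyperplanes] at hz hz'
  induction i with
  | zero => simp
  | succ i ih =>
    have hfi := dn_pow_mem hf i
    rw [pow_succ', Module.End.mul_apply, proj_dn h hb hba hz.1 hz.2.1 hz.2.2 hfi,
      proj_dn h hb hba hz'.1 hz'.2.1 hz'.2.2 hfi, hzz', add_sub_add_right_eq_sub, ← smul_sub,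
      ← map_sub, ih, map_smul, smul_smul, ← pow_succ', Module.End.mul_apply]

/-- The decomposition of a chain killed by `∂ ^ i`, with last components killed by `∂ ^ i`, too. -/
theorem exists_decomposition_of_dn_pow_eq_zero (h : IsQGeometry n q Q) (hq : (q : F) ≠ 0)
    {a b : Q} (hb : rk b + 1 = rk a) (hba : b ≤ a) {j : ℤ} {f : Q → F} (hf : f ∈ chains F a j)
    {i : ℕ} (hfi : (dn F ^ i) f = 0) :
    ∃ y : Q → Q → F,
      (∀ z ∈ otherHyperplanes a b, y z ∈ chains F (z ⊓ b) (j - 1) ∧ (dn F ^ i) (y z) = 0) ∧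
      f = restr b f + lift F q b a (proj F b a f) +
        ∑ z ∈ otherHyperplanes a b, (lift F q b z (y z) - lift F q b a (y z)) := by
  classical
  -- Subtracting the average over the hyperplanes with the same intersection with `b` makes
  -- the projection commute with `∂`, and does not change the sum.
  let m : Q → Q → F := fun c =>
    (q : F)⁻¹ • ∑ z ∈ otherHyperplanes a b with z ⊓ b = c, proj F b z f
  have hm : ∀ c, m c ∈ chains F c (j - 1) := by
    intro c
    refine Submodule.smul_mem _ _ (Submodule.sum_mem _ fun z hz => ?_)
    rw [mem_filter, mem_otherHyperplanes] at hz
    rw [← hz.2]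
    exact proj_mem h hb hba hz.1.1 hf
  have hrk : ∀ z ∈ otherHyperplanes a b, rk (z ⊓ b) + 1 = rk b := by
    intro z hz
    have hzb := not_le_of_mem_otherHyperplanes h hb hz
    rw [mem_otherHyperplanes] at hz
    have := h.rk_inf_hyperplane hb hba hz.1 hzb
    omega
  refine ⟨fun z => proj F b z f - m (z ⊓ b), fun z hz => ⟨?_, ?_⟩, ?_⟩
  · exact Submodule.sub_mem _ (proj_mem h hb hba (mem_otherHyperplanes.1 hz).1 hf) (hm _)
  · have hcard : #{z' ∈ otherHyperplanes a b | z' ⊓ b = z ⊓ b} = q := by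
      rw [← h.card_hyperplanes_inf_eq hb hba (hrk z hz) inf_le_right]
      congr 1; ext z'
      simp only [mem_filter, mem_otherHyperplanes, mem_univ, true_and]
    have hconst : ∀ z' ∈ {z' ∈ otherHyperplanes a b | z' ⊓ b = z ⊓ b},
        (dn F ^ i) (proj F b z' f) = (dn F ^ i) (proj F b z f) := by
      intro z' hz'
      rw [mem_filter] at hz'
      have := proj_dn_pow_sub h hb hba hz'.1 hz hz'.2 hf i
      rw [hfi, map_zero, map_zero, sub_zero, eq_comm, smul_eq_zero,
        or_iff_right (pow_ne_zero i hq), map_sub, sub_eq_zero] at this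
      exact this
    rw [map_sub, map_smul, map_sum, sum_congr rfl hconst, sum_const, hcard,
      ← Nat.cast_smul_eq_nsmul F, smul_smul, inv_mul_cancel₀ hq, one_smul, sub_self]
  · have hzero : ∑ z ∈ otherHyperplanes a b,
        (lift F q b z (m (z ⊓ b)) - lift F q b a (m (z ⊓ b))) = 0 := by
      rw [← sum_fiberwise (otherHyperplanes a b) (fun z => z ⊓ b)]
      refine sum_eq_zero fun c _ => ?_
      rcases ({z ∈ otherHyperplanes a b | z ⊓ b = c} : Finset Q).eq_empty_or_nonempty with
        he | ⟨z, hz⟩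
      · rw [he, sum_empty]
      · rw [mem_filter] at hz
        rw [← sum_lift_sub_lift h hq hb hba (hz.2 ▸ hrk z hz.1) (hz.2 ▸ inf_le_right) (hm c)]
        refine sum_congr rfl fun z' hz' => ?_
        rw [(mem_filter.1 hz').2]
    conv_lhs => rw [chain_decomposition h hq hb hba hf]
    congr 1
    rw [← sub_zero (∑ z ∈ otherHyperplanes a b,
      (lift F q b z (proj F b z f) - lift F q b a (proj F b z f))), ← hzero, ← sum_sub_distrib]
    refine sum_congr rfl fun z _ => ?_
    simp only [map_sub]
    abel

/-- `∂ ^ π = 0`. -/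
theorem dn_pow_eq_zero (h : IsQGeometry n q Q) (hq : (q : F) ≠ 0) {π : ℕ} (hπ0 : 0 < π)
    (hπ : ((qInt q π : ℕ) : F) = 0) (k : ℕ) {a : Q} (ha : rk a = k) {j : ℤ} {f : Q → F}
    (hf : f ∈ chains F a j) : (dn F ^ π) f = 0 := by
  induction k using Nat.strong_induction_on generalizing a j f with
  | _ k ih =>
  rcases Nat.eq_zero_or_pos k with rfl | hk
  · ext y
    by_contra hy
    have h1 := dn_pow_mem hf π y hy
    have h2 : f ≠ 0 := fun h0 => hy (by rw [h0]; simp)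
    obtain ⟨x, hx⟩ := Function.ne_iff.1 h2
    have h3 := hf x hx
    have h4 := h.rk_le_rk h3.1
    omega
  obtain ⟨b, hba, hb⟩ := h.exists_cocover (a := a) (by omega)
  have hab : ¬ a ≤ b := fun hle => by have := h.rk_le_rk hle; omega
  have hpb := proj_mem h hb hba le_rfl hf
  rw [chain_decomposition h hq hb hba hf, map_add, map_add, map_sum,
    ih (rk b) (by omega) rfl (restr_mem hf), sum_eq_zero, zero_add, add_zero]
  · obtain ⟨i, rfl⟩ : ∃ i, π = i + 1 := ⟨π - 1, by omega⟩
    rw [dn_pow_lift h hq hb hba le_rfl hab hpb, hπ, zero_smul, zero_add,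
      ih (rk (a ⊓ b)) ?_ rfl hpb, map_zero, smul_zero]
    have := h.rk_le_rk (inf_le_right : a ⊓ b ≤ b)
    omega
  · intro z hz
    have hza := (mem_otherHyperplanes.1 hz).1
    have hpz := proj_mem h hb hba hza hf
    rw [dn_pow_lift_sub_lift h hq hb hba hz hpz, ih (rk (z ⊓ b)) ?_ rfl hpz]
    · simp
    · have := h.rk_le_rk (inf_le_right : z ⊓ b ≤ b)
      omega

/-- The homology `H_{j,i}` of a geometry of rank `k` vanishes unless `k - π < 2 * j - i < k`.

Writing a cycle as `r + lift p`, up to summands that come from geometries of rank `k - 2`, one has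
`∂ ^ i r + [i] ∂ ^ (i - 1) p = 0` and `∂ ^ i p = 0` in a hyperplane, of rank `k - 1`. So `r` is
killed by `∂ ^ (i + 1)` and `p + ∂ r / [i]` by `∂ ^ (i - 1)`, and induction applies to both. -/
theorem exists_dn_pow_eq (h : IsQGeometry n q Q) (hq : (q : F) ≠ 0) {π : ℕ}
    (hπ : ((qInt q π : ℕ) : F) = 0) (hπ' : ∀ i, 0 < i → i < π → ((qInt q i : ℕ) : F) ≠ 0)
    (k : ℕ) {a : Q} (ha : rk a = k) {j : ℤ} {i : ℕ} (hi : i ≤ π)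
    (hk : (k : ℤ) ≤ 2 * j - i ∨ 2 * j - i ≤ k - π) {f : Q → F} (hf : f ∈ chains F a j)
    (hfi : (dn F ^ i) f = 0) : ∃ g ∈ chains F a (j + π - i), (dn F ^ (π - i)) g = f := by
  induction k using Nat.strong_induction_on generalizing a j i f with
  | _ k ih =>
  rcases Nat.eq_zero_or_pos i with rfl | hi0
  · rw [pow_zero, Module.End.one_apply] at hfi
    exact ⟨0, Submodule.zero_mem _, by rw [hfi, map_zero]⟩
  rcases hi.eq_or_lt with rfl | hiπ
  · exact ⟨f, by simpa using hf, by simp⟩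
  rcases Nat.eq_zero_or_pos k with rfl | hk0
  · -- A nonzero chain in rank `0` has `j = 0`, which contradicts the condition on `2 * j - i`.
    refine ⟨0, Submodule.zero_mem _, ?_⟩
    rw [map_zero, eq_comm]
    ext x
    by_contra hx
    have h1 := hf x hx
    have h2 := h.rk_le_rk h1.1
    omega
  obtain ⟨b, hba, hb⟩ := h.exists_cocover (a := a) (by omega)
  have hab : ¬ a ≤ b := fun hle => by have := h.rk_le_rk hle; omega
  have hinf : a ⊓ b = b := inf_eq_right.2 hba
  obtain ⟨y, hy, hdec⟩ := exists_decomposition_of_dn_pow_eq_zero h hq hb hba hf hfi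
  have hr : restr b f ∈ chains F b j := restr_mem hf
  have hp : proj F b a f ∈ chains F b (j - 1) := by
    have := proj_mem h hb hba le_rfl hf
    rwa [hinf] at this
  set r := restr b f
  set p := proj F b a f
  clear_value r p
  -- The components from geometries of rank `k - 2`.
  have hw : ∀ z ∈ otherHyperplanes a b,
      ∃ g ∈ chains F a (j + π - i),
        (dn F ^ (π - i)) g = lift F q b z (y z) - lift F q b a (y z) := by
    intro z hz
    have hza := mem_otherHyperplanes.1 hz
    have hrk := h.rk_inf_hyperplane hb hba hza.1 (not_le_of_mem_otherHyperplanes h hb hz)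
    obtain ⟨g, hg, hgy⟩ := ih (rk (z ⊓ b)) (by omega) rfl hi (by omega) (hy z hz).1 (hy z hz).2
    refine ⟨((q : F) ^ (π - i))⁻¹ • (lift F q b z g - lift F q b a g), ?_, ?_⟩
    · refine Submodule.smul_mem _ _ (Submodule.sub_mem _ ?_ ?_)
      · convert lift_mem h hb hba hza.1 hg using 2; ring
      · convert lift_mem h hb hba le_rfl hg using 2; ring
    · rw [map_smul, dn_pow_lift_sub_lift h hq hb hba hz hg, hgy, smul_smul,
        inv_mul_cancel₀ (pow_ne_zero _ hq), one_smul]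
  have hrest : (dn F ^ i) (r + lift F q b a p) = 0 := by
    rw [hdec, map_add, map_sum, sum_eq_zero, add_zero] at hfi
    · exact hfi
    · intro z hz
      rw [dn_pow_lift_sub_lift h hq hb hba hz (hy z hz).1, (hy z hz).2]
      simp
  obtain ⟨s, rfl⟩ : ∃ s, i = s + 1 := ⟨i - 1, by omega⟩
  obtain ⟨t, rfl⟩ : ∃ t, π = s + 1 + (t + 1) := ⟨π - (s + 1) - 1, by omega⟩
  have hc : ((qInt q (s + 1) : ℕ) : F) ≠ 0 := hπ' _ hi0 hiπ
  set c : F := ((qInt q (s + 1) : ℕ) : F) with hcdef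
  have hp' : p ∈ chains F (a ⊓ b) (j - 1) := by rwa [hinf]
  rw [map_add, dn_pow_lift h hq hb hba le_rfl hab hp' s, ← add_assoc] at hrest
  -- The component in `b` and the lifted component vanish separately.
  have hrest2 : (dn F ^ (s + 1)) p = 0 := by
    classical
    have hDp := dn_pow_mem hp (s + 1)
    ext x
    rw [Pi.zero_apply]
    by_cases hxb : x ≤ b
    swap
    · exact eq_zero_of_mem_chains hDp hxb
    have hcard := h.card_inf_eq hb hba hxb
    have hq0 : q ≠ 0 := fun h0 => hq (by rw [h0, Nat.cast_zero])
    obtain ⟨w, hw'⟩ : ({w | (w ≤ a ∧ ¬ w ≤ b) ∧ w ⊓ b = x} : Finset Q).Nonempty := by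
      rw [← card_pos, hcard]
      positivity
    obtain ⟨-, ⟨hwa, hwb⟩, rfl⟩ := mem_filter.1 hw'
    have hev := congrFun hrest w
    rw [Pi.add_apply, Pi.add_apply, Pi.smul_apply, Pi.smul_apply, Pi.zero_apply,
      eq_zero_of_mem_chains (dn_pow_mem hr (s + 1)) hwb,
      eq_zero_of_mem_chains (dn_pow_mem hp s) hwb, lift_apply_of F q b _ hwa hwb, smul_zero,
      zero_add, zero_add, smul_eq_mul] at hev
    have hq' : (q : F)⁻¹ ≠ 0 := inv_ne_zero hq
    simpa [hq, hq'] using hev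
  rw [hrest2, map_zero, smul_zero, add_zero] at hrest
  have hr2 : (dn F ^ (s + 2)) r = 0 := by
    have := congrArg (dn F) hrest
    rw [map_add, map_smul, ← Module.End.mul_apply, ← Module.End.mul_apply, ← pow_succ',
      ← pow_succ', hrest2, smul_zero, add_zero, map_zero] at this
    exact this
  have hp2 : (dn F ^ s) (p + c⁻¹ • dn F r) = 0 := by
    rw [map_add, map_smul, ← Module.End.mul_apply, ← pow_succ, eq_neg_of_add_eq_zero_left hrest,
      smul_neg, smul_smul, inv_mul_cancel₀ hc, one_smul, add_neg_cancel]
  obtain ⟨u, hu, hur⟩ := ih (rk b) (by omega) rfl (i := s + 2) (by omega)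
    (by push_cast at hk ⊢; omega) hr hr2
  obtain ⟨v, hv, hvp⟩ := ih (rk b) (by omega) rfl (i := s) (by omega)
    (by push_cast at hk ⊢; omega)
    (Submodule.add_mem _ hp (Submodule.smul_mem _ c⁻¹ (dn_mem hr))) hp2
  rw [show s + 1 + (t + 1) - (s + 2) = t by omega] at hur
  rw [show s + 1 + (t + 1) - s = t + 2 by omega] at hvp
  have hone : ∃ g ∈ chains F a (j + (s + 1 + (t + 1) : ℕ) - (s + 1 : ℕ)),
      (dn F ^ (t + 1)) g = r + lift F q b a p := by
    set d : F := ((qInt q (t + 1) : ℕ) : F) with hd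
    have hq' : (q : F) ^ (t + 1) ≠ 0 := pow_ne_zero _ hq
    set e : F := ((q : F) ^ (t + 1))⁻¹ with he
    -- The relation `[π] = 0`, which also makes the choice of the coefficients below work.
    have hde : d * e = -c := by
      rw [show s + 1 + (t + 1) = t + 1 + (s + 1) by ring, qInt_add] at hπ
      push_cast at hπ
      rw [← hd, ← hcdef] at hπ
      rw [eq_neg_of_add_eq_zero_left hπ, he, neg_mul, mul_right_comm, mul_inv_cancel₀ hq', one_mul]
    have hv' : v ∈ chains F b (j + (s + 1 + (t + 1) : ℕ) - (s + 1 : ℕ)) := by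
      convert hv using 2
      push_cast; ring
    have hb' : e • (dn F v - c⁻¹ • u) ∈
        chains F b (j + (s + 1 + (t + 1) : ℕ) - (s + 1 : ℕ) - 1) := by
      refine Submodule.smul_mem _ _ (Submodule.sub_mem _ (dn_mem hv') (Submodule.smul_mem _ _ ?_))
      convert hu using 2
      push_cast; ring
    refine ⟨-(d * e) • v + lift F q b a (e • (dn F v - c⁻¹ • u)), Submodule.add_mem _
      (Submodule.smul_mem _ _ (chains_mono F hba _ hv')) ?_, ?_⟩
    · convert lift_mem h hb hba le_rfl hb' using 2
      ring
    · have h1 : (dn F ^ t) (e • (dn F v - c⁻¹ • u)) = e • ((dn F ^ (t + 1)) v - c⁻¹ • r) := by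
        rw [map_smul, map_sub, map_smul, hur, ← Module.End.mul_apply, ← pow_succ]
      have h2 : (dn F ^ (t + 1)) (e • (dn F v - c⁻¹ • u)) = e • p := by
        rw [pow_succ', Module.End.mul_apply, h1, map_smul, map_sub, map_smul,
          ← Module.End.mul_apply, ← pow_succ', hvp, add_sub_cancel_right]
      rw [map_add, map_smul, dn_pow_lift h hq hb hba le_rfl hab (by rwa [hinf]), h1, h2, map_smul,
        ← hd, smul_smul d e, hde, smul_smul _ e, mul_inv_cancel₀ hq', one_smul, smul_sub,
        smul_smul (-c), neg_mul, mul_inv_cancel₀ hc]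
      module
  obtain ⟨g, hg, hgr⟩ := hone
  rw [show s + 1 + (t + 1) - (s + 1) = t + 1 by omega] at hw ⊢
  choose! w hw1 hw2 using hw
  refine ⟨g + ∑ z ∈ otherHyperplanes a b, w z,
    Submodule.add_mem _ hg (Submodule.sum_mem _ hw1), ?_⟩
  rw [map_add, map_sum, hgr, sum_congr rfl hw2, ← hdec]

end Exactness

/-! ### Rank-complementary elements -/

section Complements

variable (F : Type*) [Field F] {Q : Type*} [Lattice Q] [Fintype Q] {n q : ℕ}

/-- The value of the Möbius function of `P(n,q)` on an interval of length `r`. -/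
def moebiusWeight (q r : ℕ) : F := ∏ s ∈ range r, -(q : F) ^ s

theorem moebiusWeight_ne_zero (hq : (q : F) ≠ 0) (r : ℕ) : moebiusWeight F q r ≠ 0 :=
  prod_ne_zero_iff.2 fun s _ => neg_ne_zero.2 (pow_ne_zero s hq)

open Classical in
theorem sum_moebiusWeight (h : IsQGeometry n q Q) (x : Q) :
    ∑ z with z ≤ x, moebiusWeight F q (rk z) = if rk x = 0 then 1 else 0 := by
  induction hr : rk x generalizing x with
  | zero =>
    rw [if_pos rfl, sum_eq_single_of_mem x (by simp), hr]
    · simp [moebiusWeight]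
    · intro z hz hne
      rw [mem_filter] at hz
      exact absurd (h.eq_of_le_of_rk_le hz.2 (by omega)) hne
  | succ r ih =>
    obtain ⟨b, hbx, hb⟩ := h.exists_cocover (a := x) (by omega)
    rw [if_neg (Nat.succ_ne_zero r), ← sum_filter_add_sum_filter_not _ (fun z => z ≤ b),
      filter_filter, filter_filter]
    have h1 : ∑ z with z ≤ x ∧ z ≤ b, moebiusWeight F q (rk z) = if r = 0 then 1 else 0 := by
      rw [← ih b (by omega)]
      congr 1; ext z
      simp only [mem_filter, mem_univ, true_and]
      exact ⟨fun hz => hz.2, fun hz => ⟨hz.trans hbx, hz⟩⟩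
    have h2 : ∑ z with z ≤ x ∧ ¬ z ≤ b, moebiusWeight F q (rk z) =
        -(q : F) ^ r * ∑ y with y ≤ b, moebiusWeight F q (rk y) := by
      rw [← sum_fiberwise_of_maps_to (t := {y | y ≤ b}) (g := fun z => z ⊓ b) (by simp), mul_sum]
      refine sum_congr rfl fun y hy => ?_
      rw [mem_filter] at hy
      rw [filter_filter, sum_congr rfl (g := fun _ => moebiusWeight F q (rk y + 1)), sum_const,
        h.card_inf_eq hb hbx hy.2, moebiusWeight, prod_range_succ, ← moebiusWeight, nsmul_eq_mul]
      · have h3 := h.rk_le_rk hy.2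
        rw [show r = rk b - rk y + rk y by omega, pow_add]
        push_cast
        ring
      · intro z hz
        obtain ⟨-, ⟨h3, h4⟩, rfl⟩ := mem_filter.1 hz
        rw [h.rk_inf_hyperplane hb hbx h3 h4]
    rw [h1, h2, ih b (by omega)]
    split_ifs with hr0
    · simp [hr0]
    · simp

open Classical in
/-- The linear map sending `x` to the sum of all `y` with `x ⊓ y` of rank `0`. -/
def meetSum : (Q → F) →ₗ[F] (Q → F) where
  toFun f y := ∑ x with rk (x ⊓ y) = 0, f x
  map_add' f g := by ext; simp [sum_add_distrib]
  map_smul' c f := by ext; simp [mul_sum]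

open Classical in
theorem meetSum_apply (f : Q → F) (y : Q) :
    meetSum F f y = ∑ x with rk (x ⊓ y) = 0, f x := rfl

/-- The matrix of `meetSum` is the product of a unitriangular matrix, the diagonal matrix of
the Möbius weights, and another unitriangular matrix. -/
theorem meetSum_injective (h : IsQGeometry n q Q) (hq : (q : F) ≠ 0) :
    Function.Injective (meetSum F (Q := Q)) := by
  classical
  rw [injective_iff_map_eq_zero]
  intro f hf
  have h1 : ∀ y, ∑ z with z ≤ y, moebiusWeight F q (rk z) * ∑ x with z ≤ x, f x = 0 := by
    intro y
    have h2 := congrFun hf y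
    rw [meetSum_apply, Pi.zero_apply] at h2
    rw [← h2]
    simp_rw [mul_sum]
    rw [sum_comm' (t' := univ) (s' := fun x => {z | z ≤ x ⊓ y}) (by simp [and_comm])]
    simp_rw [← sum_mul, sum_moebiusWeight F h]
    simp [sum_filter]
  have h2 : ∀ y, ∑ x with y ≤ x, f x = 0 := by
    intro y
    induction y using WellFoundedLT.induction with
    | _ y ih =>
      have h3 := h1 y
      rw [sum_eq_single_of_mem y (by simp)] at h3
      · exact (mul_eq_zero.1 h3).resolve_left (moebiusWeight_ne_zero F hq _)
      · intro z hz hne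
        rw [mem_filter] at hz
        rw [ih z (lt_of_le_of_ne hz.2 hne), mul_zero]
  ext y
  rw [Pi.zero_apply]
  induction y using WellFoundedGT.induction with
  | _ y ih =>
    have h3 := h2 y
    rw [sum_eq_single_of_mem y (by simp)] at h3
    · exact h3
    · intro z hz hne
      rw [mem_filter] at hz
      exact ih z (lt_of_le_of_ne hz.2 (Ne.symm hne))

variable {F}

/-- A combination of elements of rank `k` is determined by the sums over the complements of the
elements of rank `n - k`. -/
theorem eq_zero_of_meetSum_eq_zero (h : IsQGeometry n q Q) (hq : (q : F) ≠ 0) (k : ℤ) {f : Q → F}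
    (hf : ∀ x, f x ≠ 0 → (rk x : ℤ) = k) (hfk : ∀ y : Q, (rk y : ℤ) = n - k → meetSum F f y = 0) :
    f = 0 := by
  classical
  obtain ⟨e, he⟩ := h.self_dual
  -- Composed with an anti-automorphism, `meetSum` is triangular with respect to the rank.
  let E : (Q → F) →ₗ[F] (Q → F) :=
    { toFun := fun g x => meetSum F g (OrderDual.ofDual (e x))
      map_add' := fun g g' => by rw [map_add]; rfl
      map_smul' := fun c g => by rw [map_smul]; rfl }
  have hE : ∀ g x, E g x = meetSum F g (OrderDual.ofDual (e x)) := fun g x => rfl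
  have hEinj : Function.Injective E := by
    intro g g' hgg'
    apply meetSum_injective F h hq
    ext y
    simpa [hE] using congrFun hgg' (e.symm (OrderDual.toDual y))
  let S : Submodule F (Q → F) :=
    { carrier := {g | ∀ x, (rk x : ℤ) ≤ k → g x = 0}
      add_mem' := fun {g g'} hg hg' x hx => by simp [hg x hx, hg' x hx]
      zero_mem' := fun _ _ => rfl
      smul_mem' := fun c g hg x hx => by simp [hg x hx] }
  have hrk : ∀ (g : Q → F) (y : Q), meetSum F g y ≠ 0 → ∃ x, g x ≠ 0 ∧ rk x + rk y ≤ n := by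
    intro g y hy
    rw [meetSum_apply] at hy
    obtain ⟨x, hx, hgx⟩ := exists_ne_zero_of_sum_ne_zero hy
    rw [mem_filter] at hx
    have h1 := h.rk_inf_add_rk_sup x y
    have h2 := h.rk_le (x ⊔ y)
    exact ⟨x, hgx, by omega⟩
  have hES : ∀ g ∈ S, E g ∈ S := by
    intro g hg x hx
    by_contra hne
    obtain ⟨y, hy, hle⟩ := hrk g _ ((hE g x).symm ▸ hne)
    have h1 : ¬ (rk y : ℤ) ≤ k := fun h1 => hy (hg y h1)
    have h2 := he x
    omega
  have hsurj : Function.Surjective (E.restrict hES) := by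
    rw [← LinearMap.injective_iff_surjective]
    intro g g' hgg'
    exact Subtype.ext (hEinj (congrArg Subtype.val hgg'))
  have hEf : E f ∈ S := by
    intro x hx
    by_contra hne
    obtain ⟨y, hy, hle⟩ := hrk f _ ((hE f x).symm ▸ hne)
    have h1 := hf y hy
    have h2 := he x
    exact hne ((hE f x).trans (hfk _ (by omega)))
  obtain ⟨⟨g, hg⟩, hgf⟩ := hsurj ⟨E f, hEf⟩
  have hgf' : g = f := hEinj (congrArg Subtype.val hgf)
  subst hgf'
  ext x
  by_contra hne
  exact hne (hg x (hf x hne).le)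

end Complements

/-! ### Sets and subspaces -/

section Concrete

theorem isQGeometry_finset (n : ℕ) : IsQGeometry n 1 (Finset (Fin n)) where
  rk_lt hxy := by
    rw [rk_finset, rk_finset]
    exact card_lt_card hxy
  rk_inf_add_rk_sup x y := by
    simp only [rk_finset, inf_eq_inter, sup_eq_union]
    exact card_inter_add_card_union x y
  card_covers {x a} hxa := by
    simp only [rk_finset]
    rw [← card_sdiff_of_subset hxa, qInt]
    simp only [one_pow, sum_const, card_range, smul_eq_mul, mul_one]
    rw [Nat.card_eq_fintype_card, Fintype.card_subtype]
    symm
    refine card_bij (fun i _ => insert i x) ?_ ?_ ?_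
    · intro i hi
      rw [mem_sdiff] at hi
      rw [mem_filter]
      exact ⟨mem_univ _, subset_insert i x, insert_subset hi.1 hxa, card_insert_of_notMem hi.2⟩
    · intro i hi i' hi' heq
      rw [mem_sdiff] at hi hi'
      have : i ∈ insert i' x := heq ▸ mem_insert_self i x
      exact (mem_insert.1 this).resolve_right hi.2
    · intro w hw
      obtain ⟨-, hxw, hwa, hcard⟩ := mem_filter.1 hw
      obtain ⟨i, hi, rfl⟩ := exists_eq_insert_iff.2 ⟨hxw, hcard.symm⟩
      exact ⟨i, mem_sdiff.2 ⟨hwa (mem_insert_self i x), hi⟩, rfl⟩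
  exists_top := ⟨⊤, by rw [rk_finset]; simp, fun _ => le_top⟩
  self_dual := by
    refine ⟨OrderIso.compl _, fun x => ?_⟩
    rw [rk_finset, rk_finset]
    simp

theorem natCard_diff {K V : Type*} [Field K] [Finite K] [AddCommGroup V] [Module K V]
    [FiniteDimensional K V] {X W : Submodule K V} (hXW : X ≤ W) :
    Nat.card {v : V // v ∈ W ∧ v ∉ X} + Nat.card K ^ Module.finrank K X =
      Nat.card K ^ Module.finrank K W := by
  have : Finite V := Module.finite_of_finite K
  rw [← Module.natCard_eq_pow_finrank (K := K) (V := X),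
    ← Module.natCard_eq_pow_finrank (K := K) (V := W)]
  exact Set.ncard_sdiff_add_ncard_of_subset (s := (X : Set V)) (t := W) hXW

theorem isQGeometry_submodule (K : Type) [Field K] [Finite K] (n : ℕ) :
    IsQGeometry n (Nat.card K) (Submodule K (Fin n → K)) where
  rk_lt hxy := by
    rw [rk_submodule, rk_submodule]
    exact Submodule.finrank_lt_finrank_of_lt hxy
  rk_inf_add_rk_sup x y := by
    simp only [rk_submodule]
    rw [add_comm, Submodule.finrank_sup_add_finrank_inf_eq]
  card_covers {x a} hxa := by
    have : Finite (Fin n → K) := inferInstance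
    have : Fintype (Submodule K (Fin n → K)) := Fintype.ofFinite _
    simp only [rk_submodule]
    set I := {W : Submodule K (Fin n → K) // x ≤ W ∧ W ≤ a ∧
      Module.finrank K W = Module.finrank K x + 1} with hI
    have : Fintype I := Fintype.ofFinite _
    -- Every vector of `a` outside `x` spans, together with `x`, exactly one cover of `x`.
    let f : (Σ W : I, {v : Fin n → K // v ∈ W.1 ∧ v ∉ x}) →
        {v : Fin n → K // v ∈ a ∧ v ∉ x} := fun p => ⟨p.2.1, p.1.2.2.1 p.2.2.1, p.2.2.2⟩
    have hf : Function.Bijective f := by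
      have hspan : ∀ v ∉ x, Module.finrank K (x ⊔ K ∙ v : Submodule K (Fin n → K)) =
          Module.finrank K x + 1 := by
        intro v hv
        have h1 : x < x ⊔ K ∙ v := by
          rw [left_lt_sup, Submodule.span_singleton_le_iff_mem]
          exact hv
        have h2 := Submodule.finrank_lt_finrank_of_lt h1
        have h3 := Submodule.finrank_add_le_finrank_add_finrank x (K ∙ v)
        have h4 := finrank_span_le_card (R := K) ({v} : Set (Fin n → K))
        simp only [Set.toFinset_singleton, card_singleton] at h4
        omega
      have huniq : ∀ (W : I) (v : Fin n → K), v ∈ W.1 → v ∉ x → W.1 = x ⊔ K ∙ v := by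
        intro W v hvW hvx
        symm
        apply Submodule.eq_of_le_of_finrank_eq
        · rw [sup_le_iff, Submodule.span_singleton_le_iff_mem]
          exact ⟨W.2.1, hvW⟩
        · rw [hspan v hvx, W.2.2.2]
      constructor
      · rintro ⟨W, v, hv⟩ ⟨W', v', hv'⟩ heq
        have hvv : v = v' := congrArg Subtype.val heq
        subst hvv
        have hWW : W = W' := Subtype.ext ((huniq W v hv.1 hv.2).trans (huniq W' v hv'.1 hv'.2).symm)
        subst hWW
        rfl
      · rintro ⟨v, hva, hvx⟩
        refine ⟨⟨⟨x ⊔ K ∙ v, le_sup_left, ?_, hspan v hvx⟩, v, ?_, hvx⟩, rfl⟩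
        · rw [sup_le_iff, Submodule.span_singleton_le_iff_mem]
          exact ⟨hxa, hva⟩
        · exact Submodule.mem_sup_right (Submodule.mem_span_singleton_self v)
    have hcard := Nat.card_congr (Equiv.ofBijective f hf)
    have hK : 1 < Nat.card K := Finite.one_lt_card
    have hx0 : 0 < Nat.card K ^ Module.finrank K x := by positivity
    have hW : ∀ W : I, Nat.card {v : Fin n → K // v ∈ W.1 ∧ v ∉ x} =
        Nat.card K ^ Module.finrank K x * (Nat.card K - 1) := by
      intro W
      have := natCard_diff W.2.1
      rw [W.2.2.2, pow_succ] at this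
      rw [Nat.mul_sub, mul_one, ← this, Nat.add_sub_cancel]
    rw [Nat.card_sigma, sum_congr rfl (fun W _ => hW W), sum_const, card_univ, smul_eq_mul,
      ← Nat.card_eq_fintype_card] at hcard
    have ha := natCard_diff hxa
    have hle := Submodule.finrank_mono hxa
    obtain ⟨m, hm⟩ := Nat.exists_eq_add_of_le hle
    rw [← hcard, hm, pow_add] at ha
    rw [hm, Nat.add_sub_cancel_left]
    zify [hK.le] at ha
    have h1 : ((Nat.card I : ℤ) * ((Nat.card K : ℤ) - 1)) = (Nat.card K : ℤ) ^ m - 1 := by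
      have h2 : (Nat.card K : ℤ) ^ Module.finrank K x ≠ 0 := by exact_mod_cast hx0.ne'
      apply mul_left_cancel₀ h2
      linear_combination ha
    rw [← geom_sum_mul] at h1
    have h3 : (Nat.card K : ℤ) - 1 ≠ 0 := by
      have : (1 : ℤ) < Nat.card K := by exact_mod_cast hK
      omega
    have h4 := mul_right_cancel₀ h3 h1
    rw [qInt]
    exact_mod_cast h4
  exists_top := ⟨⊤, by rw [rk_submodule]; simp, fun _ => le_top⟩
  self_dual := by
    let e : Module.Dual K (Fin n → K) ≃ₗ[K] (Fin n → K) :=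
      LinearEquiv.ofFinrankEq _ _ Subspace.dual_finrank_eq
    refine ⟨Subspace.orderIsoFiniteDimensional.trans (Submodule.orderIsoMapComap e).dual,
      fun x => ?_⟩
    rw [rk_submodule, rk_submodule]
    have h1 := Subspace.finrank_add_finrank_dualAnnihilator_eq x
    rw [Module.finrank_fin_fun] at h1
    have h2 : Module.finrank K (x.dualAnnihilator.map (e : _ →ₗ[K] (Fin n → K))) =
      Module.finrank K x.dualAnnihilator := LinearEquiv.finrank_map_eq e _
    rw [← h2, add_comm] at h1
    exact h1

theorem IsQGeometry.of_orderIso {n q : ℕ} {Q L : Type*} [P : PartialOrder Q] [Lattice L]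
    (h : IsQGeometry n q L) (e : Q ≃o L) :
    ∃ L' : Lattice Q, L'.toSemilatticeInf.toPartialOrder = P ∧ IsQGeometry n q Q := by
  let L' : Lattice Q :=
    { P with
      sup := fun a b => e.symm (e a ⊔ e b)
      inf := fun a b => e.symm (e a ⊓ e b)
      le_sup_left := fun a b => by rw [e.le_symm_apply]; exact le_sup_left
      le_sup_right := fun a b => by rw [e.le_symm_apply]; exact le_sup_right
      sup_le := fun a b c hac hbc => by
        rw [e.symm_apply_le]; exact sup_le (e.monotone hac) (e.monotone hbc)
      inf_le_left := fun a b => by rw [e.symm_apply_le]; exact inf_le_left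
      inf_le_right := fun a b => by rw [e.symm_apply_le]; exact inf_le_right
      le_inf := fun a b c hac hbc => by
        rw [e.le_symm_apply]; exact le_inf (e.monotone hac) (e.monotone hbc) }
  refine ⟨L', rfl, ?_⟩
  have hinf : ∀ x y : Q, e (x ⊓ y) = e x ⊓ e y := fun x y => e.apply_symm_apply _
  have hsup : ∀ x y : Q, e (x ⊔ y) = e x ⊔ e y := fun x y => e.apply_symm_apply _
  refine ⟨fun {x y} hxy => ?_, fun x y => ?_, fun {x a} hxa => ?_, ?_, ?_⟩
  · rw [← rk_orderIso e x, ← rk_orderIso e y]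
    exact h.rk_lt (e.strictMono hxy)
  · have := h.rk_inf_add_rk_sup (e x) (e y)
    rwa [← hinf, ← hsup, rk_orderIso, rk_orderIso, rk_orderIso, rk_orderIso] at this
  · rw [← rk_orderIso e x, ← rk_orderIso e a, ← h.card_covers (e.monotone hxa)]
    refine Nat.card_congr (e.toEquiv.subtypeEquiv fun w => ?_)
    simp only [RelIso.coe_fn_toEquiv, e.le_iff_le, rk_orderIso]
  · obtain ⟨a, ha, hle⟩ := h.exists_top
    refine ⟨e.symm a, (rk_orderIso e.symm a).trans ha, fun x => ?_⟩
    rw [e.le_symm_apply]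
    exact hle _
  · obtain ⟨d, hd⟩ := h.self_dual
    refine ⟨(e.trans d).trans e.symm.dual, fun x => ?_⟩
    have := hd (e x)
    rw [← this, rk_orderIso e x]
    congr 1
    exact rk_orderIso e.symm (OrderDual.ofDual (d (e x)))

/-- The given order of a copy of `P(n,q)` comes from a lattice; the equation of orders makes the
lattice available to statements about the given order. -/
theorem IsPnq.exists_lattice {n q : ℕ} {Q : Type*} [P : PartialOrder Q] (hQ : IsPnq n q Q) :
    ∃ L : Lattice Q, L.toSemilatticeInf.toPartialOrder = P ∧ IsQGeometry n q Q := by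
  rcases hQ with ⟨rfl, ⟨e⟩⟩ | ⟨K, _, _, rfl, ⟨e⟩⟩
  · exact (isQGeometry_finset n).of_orderIso e
  · exact (isQGeometry_submodule K n).of_orderIso e

end Concrete

/-! ### Additivity of composition multiplicities -/

section Additivity

variable {R : Type*} [Ring R] {M : Type*} [AddCommGroup M] [Module R M]
  {M' : Type*} [AddCommGroup M'] [Module R M'] (U : Type*) [AddCommGroup U] [Module R U]

theorem nonempty_quotient_map_equiv {f : M →ₗ[R] M'} (hf : Function.Injective f)
    (A B : Submodule R M) :
    Nonempty ((↥(B.map f) ⧸ (A.map f).submoduleOf (B.map f)) ≃ₗ[R] ↥B ⧸ A.submoduleOf B) := by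
  refine ⟨(Submodule.Quotient.equiv _ _ (Submodule.equivMapOfInjective f hf B) ?_).symm⟩
  ext ⟨x, hx⟩
  obtain ⟨b, hb, rfl⟩ := hx
  simp only [Submodule.mem_map, Submodule.submoduleOf, Submodule.mem_comap, Submodule.subtype_apply,
    Subtype.exists]
  constructor
  · rintro ⟨a, ha, haA, heq⟩
    exact ⟨a, haA, congrArg Subtype.val heq⟩
  · rintro ⟨a, haA, heq⟩
    obtain rfl := hf heq
    exact ⟨a, hb, haA, rfl⟩

theorem nonempty_quotient_comap_equiv {g : M →ₗ[R] M'} (hg : Function.Surjective g)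
    (A B : Submodule R M') :
    Nonempty ((↥(B.comap g) ⧸ (A.comap g).submoduleOf (B.comap g)) ≃ₗ[R]
      ↥B ⧸ A.submoduleOf B) := by
  let φ : ↥(B.comap g) →ₗ[R] ↥B ⧸ A.submoduleOf B :=
    (A.submoduleOf B).mkQ ∘ₗ g.restrict (p := B.comap g) (q := B) fun _ hx => hx
  have hφ : Function.Surjective φ := by
    refine (Submodule.mkQ_surjective _).comp ?_
    rintro ⟨b, hb⟩
    obtain ⟨x, rfl⟩ := hg b
    exact ⟨⟨x, hb⟩, rfl⟩
  have hker : (A.comap g).submoduleOf (B.comap g) = LinearMap.ker φ := by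
    ext x
    rw [LinearMap.mem_ker]
    simp only [φ, LinearMap.comp_apply, Submodule.mkQ_apply, Submodule.Quotient.mk_eq_zero]
    rfl
  exact ⟨(Submodule.quotEquivOfEq _ _ hker).trans (φ.quotKerEquivOfSurjective hφ)⟩

theorem factorCount_map (s : CompositionSeries (Submodule R M)) {f : M →ₗ[R] M'}
    (hf : Function.Injective f) :
    factorCount (s.map ⟨Submodule.map f, Submodule.map_covBy_of_injective hf⟩) U =
      factorCount s U := by
  refine Nat.card_congr ((Equiv.refl (Fin s.length)).subtypeEquiv fun i => ?_)
  obtain ⟨e⟩ := nonempty_quotient_map_equiv hf (s i.castSucc) (s i.succ)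
  exact ⟨fun ⟨g⟩ => ⟨e.symm.trans g⟩, fun ⟨g⟩ => ⟨e.trans g⟩⟩

theorem factorCount_comap (s : CompositionSeries (Submodule R M')) {g : M →ₗ[R] M'}
    (hg : Function.Surjective g) :
    factorCount (s.map ⟨Submodule.comap g, Submodule.comap_covBy_of_surjective hg⟩) U =
      factorCount s U := by
  refine Nat.card_congr ((Equiv.refl (Fin s.length)).subtypeEquiv fun i => ?_)
  obtain ⟨e⟩ := nonempty_quotient_comap_equiv hg (s i.castSucc) (s i.succ)
  exact ⟨fun ⟨g⟩ => ⟨e.symm.trans g⟩, fun ⟨g⟩ => ⟨e.trans g⟩⟩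

theorem factorCount_smash (s t : CompositionSeries (Submodule R M)) (hst : s.last = t.head) :
    factorCount (s.smash t hst) U = factorCount s U + factorCount t U := by
  let P : Submodule R M → Submodule R M → Prop := fun A B =>
    Nonempty ((↥B ⧸ A.submoduleOf B) ≃ₗ[R] U)
  let e : {i : Fin s.length // P (s i.castSucc) (s i.succ)} ⊕
      {i : Fin t.length // P (t i.castSucc) (t i.succ)} ≃
      {i : Fin (s.length + t.length) // P (s.smash t hst i.castSucc) (s.smash t hst i.succ)} :=
    (Equiv.sumCongr
      (Equiv.subtypeEquivRight fun i => Iff.of_eq (congrArg₂ P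
        (RelSeries.smash_castAdd hst i) (RelSeries.smash_succ_castAdd hst i)).symm)
      (Equiv.subtypeEquivRight fun i => Iff.of_eq (congrArg₂ P
        (RelSeries.smash_natAdd hst i) (RelSeries.smash_succ_natAdd hst i)).symm)).trans
    (Equiv.subtypeSum.symm.trans (finSumFinEquiv.subtypeEquiv
      (p := fun k => P (s.smash t hst (finSumFinEquiv k).castSucc)
        (s.smash t hst (finSumFinEquiv k).succ)) fun _ => Iff.rfl))
  exact (Nat.card_congr e).symm.trans Nat.card_sum

/-- Composition multiplicities are additive along short exact sequences. -/
theorem mult_eq_add_of_surjective [IsNoetherian R M] [IsArtinian R M] {g : M →ₗ[R] M'}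
    (hg : Function.Surjective g) :
    mult R M U = mult R (LinearMap.ker g) U + mult R M' U := by
  have := isNoetherian_of_surjective g (LinearMap.range_eq_top.2 hg)
  have := isArtinian_of_surjective _ g hg
  obtain ⟨s, hs0, hs1⟩ :=
    exists_compositionSeries_of_isNoetherian_isArtinian R (LinearMap.ker g)
  obtain ⟨t, ht0, ht1⟩ := exists_compositionSeries_of_isNoetherian_isArtinian R M'
  have hinj := Submodule.subtype_injective (LinearMap.ker g)
  let s' : CompositionSeries (Submodule R M) :=
    s.map ⟨Submodule.map (LinearMap.ker g).subtype, Submodule.map_covBy_of_injective hinj⟩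
  let t' : CompositionSeries (Submodule R M) :=
    t.map ⟨Submodule.comap g, Submodule.comap_covBy_of_surjective hg⟩
  have hs'0 : s'.head = ⊥ := (congrArg (Submodule.map _) hs0).trans (Submodule.map_bot _)
  have hs'1 : s'.last = LinearMap.ker g :=
    (congrArg (Submodule.map _) hs1).trans (Submodule.map_subtype_top _)
  have ht'0 : t'.head = LinearMap.ker g := congrArg (Submodule.comap g) ht0
  have ht'1 : t'.last = ⊤ := (congrArg (Submodule.comap g) ht1).trans (Submodule.comap_top _)
  have hst : s'.last = t'.head := hs'1.trans ht'0.symm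
  rw [mult_eq U s hs0 hs1, mult_eq U t ht0 ht1,
    mult_eq U (s'.smash t' hst) ((RelSeries.head_smash hst).trans hs'0)
      ((RelSeries.last_smash hst).trans ht'1), factorCount_smash,
    factorCount_map U s hinj, factorCount_comap U t hg]

theorem mult_of_subsingleton [Subsingleton M] : mult R M U = 0 := by
  let s : CompositionSeries (Submodule R M) := RelSeries.singleton _ ⊥
  have hs : s.head = ⊥ := rfl
  have hs' : s.last = ⊤ := Subsingleton.elim _ _
  rw [mult_eq U s hs hs', factorCount]
  have : IsEmpty (Fin s.length) := inferInstanceAs (IsEmpty (Fin 0))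
  simp

theorem mult_congr [IsNoetherian R M] [IsArtinian R M] (e : M ≃ₗ[R] M') :
    mult R M U = mult R M' U := by
  have h1 := mult_eq_add_of_surjective U (g := (e : M →ₗ[R] M')) e.surjective
  have : Subsingleton (LinearMap.ker (e : M →ₗ[R] M')) := by
    rw [LinearEquiv.ker]
    infer_instance
  rwa [mult_of_subsingleton (M := LinearMap.ker _), zero_add] at h1

theorem mult_quotient_add [IsNoetherian R M] [IsArtinian R M] (A : Submodule R M) :
    mult R M U = mult R A U + mult R (M ⧸ A) U := by
  rw [mult_eq_add_of_surjective U A.mkQ_surjective, Submodule.ker_mkQ]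

theorem mult_le_of_injective [IsNoetherian R M'] [IsArtinian R M'] {f : M →ₗ[R] M'}
    (hf : Function.Injective f) : mult R M U ≤ mult R M' U := by
  have := isNoetherian_of_injective f hf
  have := isArtinian_of_injective f hf
  rw [mult_congr U (LinearEquiv.ofInjective f hf), mult_quotient_add U (LinearMap.range f)]
  exact Nat.le_add_right _ _

end Additivity

/-! ### The permutation module -/

section PermutationModule

variable {F : Type*} [Field F] {Q : Type*} [PartialOrder Q]

instance (G : Subgroup (Q ≃o Q)) : IsScalarTower F (MonoidAlgebra F G) (FQ F G) where
  smul_assoc c a v := by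
    apply (toFinsupp F G).injective
    rw [toFinsupp_smul, map_smul, LinearMap.smul_apply, map_smul, toFinsupp_smul]

variable [Fintype Q]

/-- The elements of `FQ` as functions. -/
def coeffs (G : Subgroup (Q ≃o Q)) : FQ F G ≃ₗ[F] (Q → F) :=
  (toFinsupp F G).trans (Finsupp.linearEquivFunOnFinite F F Q)

variable (G : Subgroup (Q ≃o Q))

instance : IsNoetherian (MonoidAlgebra F G) (FQ F G) := by
  have : Module.Finite F (FQ F G) := Module.Finite.equiv (coeffs G).symm
  exact isNoetherian_of_tower F inferInstance

instance : IsArtinian (MonoidAlgebra F G) (FQ F G) := by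
  have : Module.Finite F (FQ F G) := Module.Finite.equiv (coeffs G).symm
  exact isArtinian_of_tower F inferInstance

theorem coeffs_apply (v : FQ F G) (x : Q) : coeffs G v x = toFinsupp F G v x := rfl

theorem coeffs_single_smul (g : G) (c : F) (v : FQ F G) :
    coeffs G (MonoidAlgebra.single g c • v) =
      c • LinearMap.funLeft F F (g : Q ≃o Q).symm (coeffs G v) := by
  have h1 : ∀ w : Q →₀ F, ∀ x, permRep F G g w x = w ((g : Q ≃o Q).symm x) := by
    intro w x
    classical
    induction w using Finsupp.induction_linear with
    | zero => simp
    | add v w hv hw => simp [hv, hw]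
    | single y c =>
      rw [permRep_single, Finsupp.single_apply, Finsupp.single_apply]
      congr 1
      rw [OrderIso.eq_symm_apply]
  ext x
  rw [coeffs_apply, toFinsupp_smul, Representation.asAlgebraHom_single]
  simp [h1, coeffs_apply, LinearMap.funLeft_apply]

theorem coeffs_bd (v : FQ F G) : coeffs G (bd F G v) = dn F (coeffs G v) := by
  classical
  have h1 : ∀ w : Q →₀ F, ∀ y, incidenceLin F w y = dn F w y := by
    intro w y
    induction w using Finsupp.induction_linear with
    | zero =>
      rw [map_zero, Finsupp.coe_zero, map_zero, Pi.zero_apply]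
    | add v w hv hw =>
      rw [map_add, Finsupp.add_apply, hv, hw, Finsupp.coe_add, map_add, Pi.add_apply]
    | single x c =>
      rw [incidenceLin_single, dn_apply, Finsupp.smul_apply, Finsupp.finsetSum_apply]
      simp [Finsupp.single_apply, Finset.sum_ite_eq, Finset.sum_ite_eq']
  ext y
  exact h1 (toFinsupp F G v) y

theorem coeffs_bd_pow (i : ℕ) (v : FQ F G) :
    coeffs G ((bd F G ^ i) v) = (dn F ^ i) (coeffs G v) := by
  induction i with
  | zero => rfl
  | succ i ih =>
    rw [pow_succ', pow_succ', Module.End.mul_apply, Module.End.mul_apply, coeffs_bd, ih]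

theorem mem_MRank_iff (k : ℤ) (v : FQ F G) :
    v ∈ MRank F G k ↔ ∀ x, coeffs G v x ≠ 0 → (rk x : ℤ) = k := by
  change toFinsupp F G v ∈ Finsupp.supported F F {x : Q | (rk x : ℤ) = k} ↔ _
  rw [Finsupp.mem_supported]
  constructor
  · intro h x hx
    exact h (Finsupp.mem_support_iff.2 hx)
  · intro h x hx
    exact h x (Finsupp.mem_support_iff.1 hx)

theorem mem_MRank_iff_mem_chains {a : Q} (ha : ∀ x, x ≤ a) (k : ℤ) (v : FQ F G) :
    v ∈ MRank F G k ↔ coeffs G v ∈ chains F a k := by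
  rw [mem_MRank_iff, mem_chains]
  simp [ha]

theorem MRank_eq_bot {k : ℤ} (hk : ∀ x : Q, (rk x : ℤ) ≠ k) : MRank F G k = ⊥ := by
  rw [eq_bot_iff]
  intro v hv
  rw [mem_MRank_iff] at hv
  rw [Submodule.mem_bot, ← (coeffs G).map_eq_zero_iff]
  ext x
  by_contra hx
  exact hk x (hv x hx)

variable {G}

/-- An endomorphism of the function space that commutes with `G`, as an endomorphism of the
`FG`-module `FQ`. -/
def equivariantEnd (L : (Q → F) →ₗ[F] (Q → F))
    (hL : ∀ g ∈ G, ∀ f, L (LinearMap.funLeft F F g.symm f) = LinearMap.funLeft F F g.symm (L f)) :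
    Module.End (MonoidAlgebra F G) (FQ F G) where
  toFun v := (coeffs G).symm (L (coeffs G v))
  map_add' v w := by simp
  map_smul' a v := by
    apply (coeffs G).injective
    rw [RingHom.id_apply, LinearEquiv.apply_symm_apply]
    induction a using MonoidAlgebra.induction_linear with
    | zero => simp
    | add a b ha hb => simp only [add_smul, map_add, ha, hb]
    | single g c =>
      rw [coeffs_single_smul, coeffs_single_smul, map_smul, hL g g.2, LinearEquiv.apply_symm_apply]

theorem coeffs_equivariantEnd (L : (Q → F) →ₗ[F] (Q → F))
    (hL : ∀ g ∈ G, ∀ f, L (LinearMap.funLeft F F g.symm f) = LinearMap.funLeft F F g.symm (L f))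
    (v : FQ F G) : coeffs G (equivariantEnd L hL v) = L (coeffs G v) :=
  (coeffs G).apply_symm_apply _

end PermutationModule

/-! ### Symmetry of the multiplicities -/

section Symmetry

variable {F : Type*} [Field F] {Q : Type*} [Lattice Q] [Fintype Q] {n q : ℕ}

/-- The map sending `x` to the sum of its complements of rank `n - k` is injective on `M_k`. -/
theorem mult_MRank_le (h : IsQGeometry n q Q) (hq : (q : F) ≠ 0) (G : Subgroup (Q ≃o Q))
    (U : Type*) [AddCommGroup U] [Module (MonoidAlgebra F G) U] (k : ℤ) :
    mult (MonoidAlgebra F G) (MRank F G k) U ≤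
      mult (MonoidAlgebra F G) (MRank F G (n - k)) U := by
  classical
  let L : (Q → F) →ₗ[F] (Q → F) :=
    { toFun := fun f y => if (rk y : ℤ) = n - k then meetSum F f y else 0
      map_add' := fun f f' => by ext; simp only [map_add, Pi.add_apply]; split_ifs <;> simp
      map_smul' := fun c f => by
        ext; simp only [map_smul, Pi.smul_apply, RingHom.id_apply]; split_ifs <;> simp }
  have hLapply : ∀ f y, L f y = if (rk y : ℤ) = n - k then meetSum F f y else 0 := fun f y => rfl
  have hL : ∀ g ∈ G, ∀ f,
      L (LinearMap.funLeft F F g.symm f) = LinearMap.funLeft F F g.symm (L f) := by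
    intro g _ f
    ext y
    rw [LinearMap.funLeft_apply, hLapply, hLapply, rk_orderIso]
    split_ifs with hy
    · rw [meetSum_apply, meetSum_apply]
      refine Finset.sum_equiv g.symm.toEquiv (fun x => ?_) (fun x _ => rfl)
      simp only [Finset.mem_filter, Finset.mem_univ, true_and, RelIso.coe_fn_toEquiv]
      rw [← map_inf, rk_orderIso]
    · rfl
  have hmem : ∀ v ∈ MRank F G k, equivariantEnd L hL v ∈ MRank F G (n - k) := by
    intro v _
    rw [mem_MRank_iff]
    intro x hx
    by_contra hne
    exact hx (by rw [coeffs_equivariantEnd, hLapply, if_neg hne])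
  refine mult_le_of_injective U (f := (equivariantEnd L hL).restrict hmem) ?_
  rw [injective_iff_map_eq_zero]
  rintro ⟨v, hv⟩ h0
  have h1 : equivariantEnd L hL v = 0 := congrArg Subtype.val h0
  rw [mem_MRank_iff] at hv
  apply Subtype.ext
  apply (coeffs G).injective
  rw [Submodule.coe_zero, map_zero]
  refine eq_zero_of_meetSum_eq_zero h hq k hv fun y hy => ?_
  have h2 := congrFun (congrArg (coeffs G) h1) y
  rwa [coeffs_equivariantEnd, hLapply, if_pos hy, map_zero] at h2

theorem mult_MRank_eq (h : IsQGeometry n q Q) (hq : (q : F) ≠ 0) (G : Subgroup (Q ≃o Q))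
    (U : Type*) [AddCommGroup U] [Module (MonoidAlgebra F G) U] (k : ℤ) :
    mult (MonoidAlgebra F G) (MRank F G k) U =
      mult (MonoidAlgebra F G) (MRank F G (n - k)) U := by
  refine le_antisymm (mult_MRank_le h hq G U k) ?_
  have := mult_MRank_le h hq G U (n - k)
  rwa [sub_sub_cancel] at this

end Symmetry

/-! ### The terms of the sequences -/

section Terms

variable {π : ℕ} {l r : ℤ}

theorem term_two_mul (π : ℕ) (l r t : ℤ) : term π l r (2 * t) = r + π * t := by
  rw [term, if_pos (even_two_mul t), show 2 * t / 2 = t by omega]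

theorem term_two_mul_sub_one (π : ℕ) (l r t : ℤ) : term π l r (2 * t - 1) = l + π * t := by
  have h1 : ¬ Even (2 * t - 1) := by simp
  rw [term, if_neg h1, show (2 * t - 1 + 1) / 2 = t by omega]

theorem term_add_one (π : ℕ) (l r e : ℤ) : term π l r (e + 1) = term π l r (e - 1) + π := by
  have h1 := term_add_term π l r e
  have h2 := term_add_term π l r (e + 1)
  rw [add_sub_cancel_right] at h2
  linarith

theorem term_sub_term (h0 : 0 < r - l) (hπ : r - l < π) (e : ℤ) :
    0 < term π l r e - term π l r (e - 1) ∧ term π l r e - term π l r (e - 1) < π := by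
  rcases Int.even_or_odd' e with ⟨t, rfl | rfl⟩
  · rw [term_two_mul, term_two_mul_sub_one]
    constructor <;> linarith
  · rw [show 2 * t + 1 = 2 * (t + 1) - 1 by ring, term_two_mul_sub_one,
      show 2 * (t + 1) - 1 - 1 = 2 * t by ring, term_two_mul]
    constructor <;> linarith

/-- The exponent of the arrow leaving the module in position `e`. -/
def stepAt (π : ℕ) (l r e : ℤ) : ℕ := (term π l r e - term π l r (e - 1)).toNat

theorem stepAt_cast (h0 : 0 < r - l) (hπ : r - l < π) (e : ℤ) :
    (stepAt π l r e : ℤ) = term π l r e - term π l r (e - 1) :=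
  Int.toNat_of_nonneg (term_sub_term h0 hπ e).1.le

theorem stepAt_lt (h0 : 0 < r - l) (hπ : r - l < π) (e : ℤ) : stepAt π l r e < π := by
  have := (term_sub_term h0 hπ e).2
  rw [← stepAt_cast h0 hπ] at this
  exact_mod_cast this

theorem stepAt_add_one (h0 : 0 < r - l) (hπ : r - l < π) (e : ℤ) :
    stepAt π l r (e + 1) = π - stepAt π l r e := by
  have h1 := stepAt_cast h0 hπ e
  have h2 := stepAt_cast h0 hπ (e + 1)
  have h3 := term_add_one π l r e
  have h4 := stepAt_lt h0 hπ e
  rw [add_sub_cancel_right] at h2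
  omega

/-- The sequence of the type `(a,b)` is again determined by an arrow whose exponent lies strictly
between `0` and `π`. -/
theorem IsTypeOf.sub_bounds {a b : ℤ} (h : IsTypeOf π l r a b) (h0 : 0 < r - l) (hπ : r - l < π) :
    0 < b - a ∧ b - a < π := by
  obtain ⟨⟨e, rfl, rfl⟩, -⟩ := h
  exact term_sub_term h0 hπ e

end Terms

/-! ### Almost exactness -/

section Homology

variable {F : Type*} [Field F] {Q : Type*} [Lattice Q] [Fintype Q] {n q π : ℕ}

/-- The homology `H_{j,i}` can only be nonzero if the arrow `M_{j-i} ← M_j` is the one next to the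
middle, that is, if the sum of its indices lies strictly between `n - π` and `n`. -/
theorem nontrivial_H_bounds (h : IsQGeometry n q Q) (hq : (q : F) ≠ 0)
    (hπ : ((qInt q π : ℕ) : F) = 0) (hπ' : ∀ i, 0 < i → i < π → ((qInt q i : ℕ) : F) ≠ 0)
    (G : Subgroup (Q ≃o Q)) {j : ℤ} {i : ℕ} (hi : i ≤ π) (hH : Nontrivial (H F G π j i)) :
    (n : ℤ) - π < 2 * j - i ∧ 2 * j - i < n := by
  by_contra hcon
  rw [← not_subsingleton_iff_nontrivial] at hH
  apply hH
  rw [Submodule.Quotient.subsingleton_iff, Submodule.submoduleOf_eq_top]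
  rintro v ⟨hv1, hv2⟩
  obtain ⟨a, ha, hle⟩ := h.exists_top
  rw [SetLike.mem_coe, mem_MRank_iff_mem_chains G hle] at hv2
  rw [SetLike.mem_coe, LinearMap.mem_ker] at hv1
  have hv3 : (dn F ^ i) (coeffs G v) = 0 := by rw [← coeffs_bd_pow, hv1, map_zero]
  obtain ⟨g, hg, hgv⟩ := exists_dn_pow_eq h hq hπ hπ' n ha hi (by omega) hv2 hv3
  refine ⟨(coeffs G).symm g, ?_, ?_⟩
  · rw [SetLike.mem_coe, mem_MRank_iff_mem_chains G hle, LinearEquiv.apply_symm_apply]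
    convert hg using 2
    omega
  · apply (coeffs G).injective
    rw [coeffs_bd_pow, LinearEquiv.apply_symm_apply, hgv]

theorem almostExact (h : IsQGeometry n q Q) (hq : (q : F) ≠ 0)
    (hπ : ((qInt q π : ℕ) : F) = 0) (hπ' : ∀ i, 0 < i → i < π → ((qInt q i : ℕ) : F) ≠ 0)
    (G : Subgroup (Q ≃o Q)) {l r : ℤ} (h0 : 0 < r - l) (hlr : r - l < π) :
    AlmostExact F G π l r := by
  have key : ∀ e : ℤ, Nontrivial (HAt F G π l r e) →
      (n : ℤ) - π < l + r + π * e ∧ l + r + π * e < n := by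
    intro e he
    have h1 := nontrivial_H_bounds (i := stepAt π l r e) h hq hπ hπ' G (stepAt_lt h0 hlr e).le he
    rw [stepAt_cast h0 hlr] at h1
    rw [← term_add_term]
    constructor <;> linarith [h1.1, h1.2]
  intro e he e' he'
  have h1 := key e he
  have h2 := key e' he'
  have hπ0 : (0 : ℤ) < π := by omega
  have h3 : (π : ℤ) * (e - e') < π * 1 := by linarith [h1.2, h2.1]
  have h4 : (π : ℤ) * (e' - e) < π * 1 := by linarith [h2.2, h1.1]
  have h5 := lt_of_mul_lt_mul_left h3 hπ0.le
  have h6 := lt_of_mul_lt_mul_left h4 hπ0.le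
  omega

/-! ### The Euler characteristic -/

theorem mult_eq_mult_ker_add_mult_map {R M : Type*} [Ring R] [AddCommGroup M] [Module R M]
    [IsNoetherian R M] [IsArtinian R M] (U : Type*) [AddCommGroup U] [Module R U]
    (f : Module.End R M) (A : Submodule R M) :
    mult R A U = mult R ↥(LinearMap.ker f ⊓ A) U + mult R ↥(A.map f) U := by
  have hsurj : Function.Surjective (f.submoduleMap A) := f.submoduleMap_surjective A
  rw [mult_eq_add_of_surjective U hsurj]
  congr 1
  have hker : LinearMap.ker (f.submoduleMap A) = (LinearMap.ker f ⊓ A).submoduleOf A := by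
    ext x
    rw [LinearMap.mem_ker, ← Subtype.coe_inj]
    simp [Submodule.submoduleOf]
  rw [hker]
  exact mult_congr U (Submodule.submoduleOfEquivOfLe inf_le_right)

/-- Since `∂ ^ π = 0`, the cycles are made up of the boundaries and the homology. -/
theorem mult_ker_eq (h : IsQGeometry n q Q) (hq : (q : F) ≠ 0) (hπ0 : 0 < π)
    (hπ : ((qInt q π : ℕ) : F) = 0) (G : Subgroup (Q ≃o Q)) (U : Type*) [AddCommGroup U]
    [Module (MonoidAlgebra F G) U] (j : ℤ) {i : ℕ} (hi : i ≤ π) :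
    mult (MonoidAlgebra F G) ↥(LinearMap.ker (bd F G ^ i) ⊓ MRank F G j) U =
      mult (MonoidAlgebra F G) ↥((MRank F G (j + (π - i : ℕ))).map (bd F G ^ (π - i))) U +
        mult (MonoidAlgebra F G) (H F G π j i) U := by
  rw [mult_quotient_add U (((MRank F G (j + (π - i : ℕ))).map (bd F G ^ (π - i))).submoduleOf
      (LinearMap.ker (bd F G ^ i) ⊓ MRank F G j))]
  congr 1
  refine mult_congr U (Submodule.submoduleOfEquivOfLe ?_)
  obtain ⟨a, ha, hle⟩ := h.exists_top
  rintro _ ⟨v, hv, rfl⟩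
  rw [SetLike.mem_coe, mem_MRank_iff_mem_chains G hle] at hv
  refine ⟨?_, ?_⟩
  · rw [SetLike.mem_coe, LinearMap.mem_ker, ← Module.End.mul_apply, ← pow_add,
      Nat.add_sub_cancel' hi]
    apply (coeffs G).injective
    rw [coeffs_bd_pow, dn_pow_eq_zero h hq hπ0 hπ n ha hv, map_zero]
  · rw [SetLike.mem_coe, mem_MRank_iff_mem_chains G hle, coeffs_bd_pow]
    convert dn_pow_mem hv (π - i) using 2
    omega

/-- The Euler characteristic of the sequence determined by `M_a ← M_b`. A module in the sequence
contributes its image, the image of the arrow arriving at it, and its homology; the images cancel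
in the alternating sum. -/
theorem mult_HAt_eq (h : IsQGeometry n q Q) (hq : (q : F) ≠ 0)
    (hπ : ((qInt q π : ℕ) : F) = 0) (G : Subgroup (Q ≃o Q)) (U : Type*) [AddCommGroup U]
    [Module (MonoidAlgebra F G) U] {a b : ℤ} (h0 : 0 < b - a) (hab : b - a < π)
    (c : ℤ → ℕ) (hc : ∀ k, c k = mult (MonoidAlgebra F G) (MRank F G k) U)
    (d : ℤ) (hd : ∀ e : ℤ, Nontrivial (HAt F G π a b e) → e = d) :
    (mult (MonoidAlgebra F G) (HAt F G π a b d) U : ℤ) =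
      (d.negOnePow : ℤ) * (bracket π c b - bracket π c a) := by
  have hπ0 : 0 < π := by omega
  set m : ℤ → ℤ := fun e => (mult (MonoidAlgebra F G)
    ↥((MRank F G (term π a b e)).map (bd F G ^ stepAt π a b e)) U : ℤ) with hm
  set η : ℤ → ℤ := fun e => (mult (MonoidAlgebra F G) (HAt F G π a b e) U : ℤ) with hη
  have hη0 : ∀ e, e ≠ d → η e = 0 := by
    intro e he
    have : Subsingleton (HAt F G π a b e) := by
      rw [← not_nontrivial_iff_subsingleton]
      exact fun hnt => he (hd e hnt)
    simp only [hη]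
    rw [mult_of_subsingleton (M := HAt F G π a b e), Nat.cast_zero]
  have hdecomp : ∀ e, (c (term π a b e) : ℤ) = m (e + 1) + η e + m e := by
    intro e
    have h1 := mult_ker_eq h hq hπ0 hπ G U (term π a b e) (stepAt_lt h0 hab e).le
    have h2 : term π a b e + (π - stepAt π a b e : ℕ) = term π a b (e + 1) := by
      have h3 := stepAt_cast h0 hab e
      have h4 := stepAt_lt h0 hab e
      have h5 := term_add_one π a b e
      omega
    have h3 : mult (MonoidAlgebra F G) ↥((MRank F G (term π a b e + (π - stepAt π a b e : ℕ))).map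
        (bd F G ^ (π - stepAt π a b e))) U = mult (MonoidAlgebra F G)
          ↥((MRank F G (term π a b (e + 1))).map (bd F G ^ stepAt π a b (e + 1))) U := by
      rw [h2, stepAt_add_one h0 hab]
    rw [h3] at h1
    rw [hc, mult_eq_mult_ker_add_mult_map U (bd F G ^ stepAt π a b e), h1]
    push_cast
    rfl
  -- Only finitely many of the terms are nonzero.
  have hc0 : ∀ k, c k ≠ 0 → k ∈ Set.Icc (0 : ℤ) n := by
    intro k hk
    by_contra hcon
    have hbot : MRank F G k = ⊥ := MRank_eq_bot G fun x hx => hcon (by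
      have := h.rk_le x
      rw [Set.mem_Icc]
      omega)
    apply hk
    rw [hc, hbot, mult_of_subsingleton]
  have hfin : ∀ k : ℤ, (Function.support fun t : ℤ => (c (k + t * π) : ℤ)).Finite := by
    intro k
    refine ((Set.finite_Icc (0 : ℤ) n).preimage (f := fun t : ℤ => k + t * π) ?_).subset ?_
    · intro t _ t' _ htt
      have hπ' : (π : ℤ) ≠ 0 := by exact_mod_cast hπ0.ne'
      have htt' : t * (π : ℤ) = t' * π := by simpa using htt
      exact mul_right_cancel₀ hπ' htt'
    · intro t ht
      rw [Function.mem_support, Nat.cast_ne_zero] at ht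
      exact hc0 _ ht
  have hm_nonneg : ∀ e, 0 ≤ m e := fun e => Int.natCast_nonneg _
  have hη_nonneg : ∀ e, 0 ≤ η e := fun e => Int.natCast_nonneg _
  have heven : ∀ t : ℤ, (c (b + t * π) : ℤ) = m (2 * t + 1) + (η (2 * t) + m (2 * t)) := by
    intro t
    rw [← add_assoc, ← hdecomp, term_two_mul, mul_comm t]
  have hodd : ∀ t : ℤ, (c (a + t * π) : ℤ) = m (2 * t) + (η (2 * t - 1) + m (2 * t - 1)) := by
    intro t
    have := hdecomp (2 * t - 1)
    rw [sub_add_cancel, term_two_mul_sub_one, mul_comm _ t] at this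
    rw [this, add_assoc]
  have hsb := hfin b
  have hsa := hfin a
  have f1 : (Function.support fun t : ℤ => m (2 * t + 1)).Finite := hsb.subset fun t ht => by
    rw [Function.mem_support] at ht ⊢
    have := heven t; have := hm_nonneg (2 * t + 1); have := hm_nonneg (2 * t)
    have := hη_nonneg (2 * t); omega
  have f2 : (Function.support fun t : ℤ => η (2 * t)).Finite := hsb.subset fun t ht => by
    rw [Function.mem_support] at ht ⊢
    have := heven t; have := hm_nonneg (2 * t + 1); have := hm_nonneg (2 * t)
    have := hη_nonneg (2 * t); omega
  have f3 : (Function.support fun t : ℤ => m (2 * t)).Finite := hsb.subset fun t ht => by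
    rw [Function.mem_support] at ht ⊢
    have := heven t; have := hm_nonneg (2 * t + 1); have := hm_nonneg (2 * t)
    have := hη_nonneg (2 * t); omega
  have f4 : (Function.support fun t : ℤ => η (2 * t - 1)).Finite := hsa.subset fun t ht => by
    rw [Function.mem_support] at ht ⊢
    have := hodd t; have := hm_nonneg (2 * t - 1); have := hm_nonneg (2 * t)
    have := hη_nonneg (2 * t - 1); omega
  have f5 : (Function.support fun t : ℤ => m (2 * t - 1)).Finite := hsa.subset fun t ht => by
    rw [Function.mem_support] at ht ⊢
    have := hodd t; have := hm_nonneg (2 * t - 1); have := hm_nonneg (2 * t)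
    have := hη_nonneg (2 * t - 1); omega
  have hb : bracket π c b =
      ∑ᶠ t : ℤ, m (2 * t + 1) + (∑ᶠ t : ℤ, η (2 * t) + ∑ᶠ t : ℤ, m (2 * t)) := by
    rw [bracket, finsum_congr heven, finsum_add_distrib f1 ((f2.union f3).subset
      (Function.support_add _ _)), finsum_add_distrib f2 f3]
  have ha : bracket π c a =
      ∑ᶠ t : ℤ, m (2 * t) + (∑ᶠ t : ℤ, η (2 * t - 1) + ∑ᶠ t : ℤ, m (2 * t - 1)) := by
    rw [bracket, finsum_congr hodd, finsum_add_distrib f3 ((f4.union f5).subset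
      (Function.support_add _ _)), finsum_add_distrib f4 f5]
  have hshift : ∑ᶠ t : ℤ, m (2 * t + 1) = ∑ᶠ t : ℤ, m (2 * t - 1) := by
    rw [← finsum_comp_equiv (Equiv.addRight (1 : ℤ)) (f := fun t => m (2 * t - 1))]
    refine finsum_congr fun t => ?_
    rw [Equiv.coe_addRight, show 2 * (t + 1) - 1 = 2 * t + 1 by ring]
  have hdiff : bracket π c b - bracket π c a =
      ∑ᶠ t : ℤ, η (2 * t) - ∑ᶠ t : ℤ, η (2 * t - 1) := by
    rw [hb, ha, hshift]; ring
  rw [hdiff]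
  change η d = _
  rcases Int.even_or_odd' d with ⟨s, hs | hs⟩
  · rw [finsum_eq_single (fun t : ℤ => η (2 * t)) s fun t ht => hη0 _ (by omega),
      finsum_congr (g := fun _ => 0) fun t : ℤ => hη0 (2 * t - 1) (by omega), finsum_zero,
      Int.negOnePow_even d (by rw [hs]; exact even_two_mul s), hs]
    simp
  · rw [finsum_eq_single (fun t : ℤ => η (2 * t - 1)) (s + 1) fun t ht => hη0 _ (by omega),
      finsum_congr (g := fun _ => 0) fun t : ℤ => hη0 (2 * t) (by omega), finsum_zero,
      Int.negOnePow_odd d ⟨s, hs⟩, show 2 * (s + 1) - 1 = d by omega]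
    simp

end Homology

/-! ### The characteristic of `q` modulo `p` -/

section Characteristic

theorem qInt_qchar {p q : ℕ} (F : Type*) [Field F] [CharP F p] (h0 : 0 < qchar p q) :
    ((qInt q (qchar p q) : ℕ) : F) = 0 ∧
      ∀ i, 0 < i → i < qchar p q → ((qInt q i : ℕ) : F) ≠ 0 := by
  have hne : {m : ℕ | 0 < m ∧ p ∣ ∑ s ∈ Finset.range m, q ^ s}.Nonempty :=
    Nat.nonempty_of_pos_sInf h0
  refine ⟨(CharP.cast_eq_zero_iff F p _).2 (Nat.sInf_mem hne).2, fun i hi hlt hzero => ?_⟩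
  exact Nat.notMem_of_lt_sInf hlt ⟨hi, (CharP.cast_eq_zero_iff F p _).1 hzero⟩

end Characteristic

end IncidenceHomology

end

open IncidenceHomology in
theorem mainTheorem2 {Q F U : Type*} [PartialOrder Q] [Fintype Q] [Field F]
    (n q p : ℕ) (hQ : IsPnq n q Q) (hp : p.Prime) [CharP F p] (hpq : Nat.Coprime p q)
    (G : Subgroup (Q ≃o Q))
    [AddCommGroup U] [Module (MonoidAlgebra F G) U] [IsSimpleModule (MonoidAlgebra F G) U]
    (π : ℕ) (hπ : π = qchar p q)
    (c : ℤ → ℕ) (hc : ∀ k, c k = mult (MonoidAlgebra F G) (MRank F G k) U) :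
    (∀ k : ℤ, c k = c (n - k)) ∧
    ∀ l r : ℤ, 0 < r - l → r - l < π →
      AlmostExact F G π l r ∧
      ∀ a b : ℤ, IsTypeOf π l r a b →
        ∀ d : ℤ, (∀ e : ℤ, Nontrivial (HAt F G π a b e) → e = d) →
          (mult (MonoidAlgebra F G) (HAt F G π a b d) U : ℤ) =
              (d.negOnePow : ℤ) * (bracket π c b - bracket π c a) ∧
          (Even d → bracket π c a ≤ bracket π c b) ∧
          (Odd d → bracket π c b ≤ bracket π c a) := by
  obtain ⟨L, rfl, h⟩ := hQ.exists_lattice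
  have hq : (q : F) ≠ 0 := by
    rw [Ne, CharP.cast_eq_zero_iff F p]
    exact fun hdvd => hp.one_lt.ne' (Nat.eq_one_of_dvd_coprimes hpq dvd_rfl hdvd)
  refine ⟨fun k => by rw [hc, hc, mult_MRank_eq h hq], fun l r h0 hlr => ?_⟩
  have hπ0 : 0 < qchar p q := by omega
  obtain ⟨h1, h2⟩ := qInt_qchar F hπ0
  rw [← hπ] at h1 h2
  refine ⟨almostExact h hq h1 h2 G h0 hlr, fun a b hab d hd => ?_⟩
  obtain ⟨h3, h4⟩ := hab.sub_bounds h0 hlr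
  have key := mult_HAt_eq h hq h1 G U h3 h4 c hc d hd
  refine ⟨key, fun heven => ?_, fun hodd => ?_⟩
  · rw [Int.negOnePow_even d heven] at key
    simp only [Units.val_one, one_mul] at key
    omega
  · rw [Int.negOnePow_odd d hodd] at key
    simp only [Units.val_neg, Units.val_one, neg_mul, one_mul] at key
    omega
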